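/- **Theorem (Existence of a stationary distribution).** *Setting.* Let $\mathsf Z$ be a finite set and $\{Z_t\}_{t\ge 0}$ a stationary Markov chain on $\mathsf Z$ with irreducible transition matrix $P$. Let $\{\epsilon_t\},\{\zeta_t\},\{\eta_t\}$ be i.i.d. sequences, independent of each other and of $\{Z_t\}$, with marginal laws $\pi_\epsilon,\pi_\zeta,\pi_\eta$. Let $\beta,R,Y$ be nonnegative measurable functions and put $\beta_t=\beta(Z_t,\epsilon_t)$, $R_t=R(Z_t,\zeta_t)$, $Y_t=Y(Z_t,\eta_t)$ for $t\ge 1$, and $\beta_0=1$. Let $u:[0,\infty)\to\mathbb R\cup\{-\infty\}$ be real-valued and twice differentiable on $(0,\infty)$ with $u'>0$, $u''<0$ there, $u(0)\le u(c)$ for all $c>0$, $u'(c)\to\infty$ as $c\downarrow 0$, and $u'(c)<1$ for all sufficiently large $c$; set $u'(0)=\infty$ and $0\cdot\infty=0$. Write $\mathbb E_z=\mathbb E[\,\cdot\mid Z_0=z]$. A *feasible policy* is a Borel function $c$ on $\mathsf S_0=(0,\infty)\times\mathsf Z$ with $0\le c(a,z)\le a$; it is extended by $c(0,z)=0$. Given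 $(a_0,Z_0)=(a,z)$ it generates $a_{t+1}=R_{t+1}\,[a_t-c(a_t,Z_t)]+Y_{t+1}$ and has lifetime value $V_c(a,z)=\mathbb E_z\sum_{t\ge 0}\beta_0\cdots\beta_t\,u(c(a_t,Z_t))\in[-\infty,\infty)$. A feasible policy $c$ is *optimal* if $V_d\le V_c$ on $\mathsf S_0$ for every feasible policy $d$. Let $\mathscr C$ be the set of continuous $c:\mathsf S_0\to\mathbb R$ that are increasing (in the weak sense) in the first argument and satisfy $0<c(a,z)\le a$ on $\mathsf S_0$ and $\sup_{(a,z)\in\mathsf S_0}|u'(c(a,z))-u'(a)|<\infty$. For $\phi_t\in\{\beta_t,\ \beta_tR_t,\ R_t\}$ let $G_\phi=\lim_{n\to\infty}\bigl(\mathbb E\prod_{t=1}^n\phi_t\bigr)^{1/n}$, where these expectations are assumed finite; denote the three numbers by $G_\beta$, $G_{\beta R}$ and $G_R$. *Assumptions.* $G_\beta<1$; $G_{\beta R}<1$; $\mathbb E\,Y_1<\infty$ and $\mathbb E\,u'(Y_1)<\infty$; and there is a constant $\bar s\in[0,1)$ with $\bar s\,G_R<1$ such that $$\mathbb E_z\,\beta_1R_1\,u'(R_1\bar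 s\,a)\le u'(a)\quad\text{for all }(a,z)\in\mathsf S_0 .$$ *Conclusion.* There is exactly one optimal policy $c^*$ in $\mathscr C$, and the stochastic kernel $Q$ of $(a_t,Z_t)$ under $c^*$, that is, $$Q((a,z),B)=\sum_{z'\in\mathsf Z}P(z,z')\iint \mathbf 1_B\bigl(R(z',\zeta)[a-c^*(a,z)]+Y(z',\eta),\,z'\bigr)\,\pi_\zeta(d\zeta)\,\pi_\eta(d\eta),$$ has at least one stationary distribution: a Borel probability measure $\psi$ on $[0,\infty)\times\mathsf Z$ with $\psi Q=\psi$. -/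

import Mathlib

open MeasureTheory ProbabilityTheory Filter Topology
open scoped NNReal ENNReal

noncomputable section

namespace IncomeFluctuation

/-- Primitives of the income fluctuation problem: a finite irreducible Markov transition
function `P` on `Z`, the laws `πε`, `πζ`, `πη` of the three innovations, the functions
`β`, `R`, `Y` giving the discount factor, the gross return and the non-financial income, and
the utility function `u` (of which only the values on `[0, ∞)` are ever used). -/
structure Primitives (Z E₁ E₂ E₃ : Type*) [Fintype Z] [MeasurableSpace Z]
    [MeasurableSingletonClass Z] [MeasurableSpace E₁] [MeasurableSpace E₂]
    [MeasurableSpace E₃] where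
  P : Z → PMF Z
  irreducible : ∀ z z', Relation.ReflTransGen (fun x y => P x y ≠ 0) z z'
  πε : Measure E₁
  πζ : Measure E₂
  πη : Measure E₃
  prob_ε : IsProbabilityMeasure πε
  prob_ζ : IsProbabilityMeasure πζ
  prob_η : IsProbabilityMeasure πη
  β : Z → E₁ → ℝ≥0
  R : Z → E₂ → ℝ≥0
  Y : Z → E₃ → ℝ≥0
  measurable_β : ∀ z, Measurable (β z)
  measurable_R : ∀ z, Measurable (R z)
  measurable_Y : ∀ z, Measurable (Y z)
  u : ℝ → EReal
  u_ne_top : ∀ c, 0 ≤ c → u c ≠ ⊤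
  u_ne_bot : ∀ c, 0 < c → u c ≠ ⊥
  u_zero_le : ∀ c, 0 < c → u 0 ≤ u c
  u_diff : DifferentiableOn ℝ (fun x => (u x).toReal) (Set.Ioi 0)
  u_diff2 : DifferentiableOn ℝ (deriv fun x => (u x).toReal) (Set.Ioi 0)
  u_deriv_pos : ∀ c, 0 < c → 0 < deriv (fun x => (u x).toReal) c
  u_deriv2_neg : ∀ c, 0 < c → deriv (deriv fun x => (u x).toReal) c < 0
  u_deriv_zero : Tendsto (deriv fun x => (u x).toReal) (𝓝[>] 0) atTop
  u_deriv_atTop : ∀ᶠ c in atTop, deriv (fun x => (u x).toReal) c < 1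

attribute [instance] Primitives.prob_ε Primitives.prob_ζ Primitives.prob_η

/-- A realization of the exogenous processes on a probability space `(Ω, μ)`: `chain` is a
stationary Markov chain with transition function `P`, and the innovation triples
`(ε t, ζ t, η t)` are i.i.d. over time with law `πε ⊗ πζ ⊗ πη` and independent of the chain. -/
structure Shocks {Z E₁ E₂ E₃ : Type*} [Fintype Z] [MeasurableSpace Z]
    [MeasurableSingletonClass Z] [MeasurableSpace E₁] [MeasurableSpace E₂]
    [MeasurableSpace E₃] (M : Primitives Z E₁ E₂ E₃)
    {Ω : Type*} [MeasurableSpace Ω] (μ : Measure Ω) where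
  chain : ℕ → Ω → Z
  ε : ℕ → Ω → E₁
  ζ : ℕ → Ω → E₂
  η : ℕ → Ω → E₃
  measurable_chain : ∀ t, Measurable (chain t)
  measurable_ε : ∀ t, Measurable (ε t)
  measurable_ζ : ∀ t, Measurable (ζ t)
  measurable_η : ∀ t, Measurable (η t)
  markov : ∀ (n : ℕ) (z : ℕ → Z),
    μ {ω | ∀ t ≤ n + 1, chain t ω = z t} = μ {ω | ∀ t ≤ n, chain t ω = z t} * M.P (z n) (z (n + 1))
  stationary : ∀ z', ∑ z, μ {ω | chain 0 ω = z} * M.P z z' = μ {ω | chain 0 ω = z'}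
  indep_chain : IndepFun (fun ω t => chain t ω) (fun ω t => (ε t ω, ζ t ω, η t ω)) μ
  indep_time : iIndepFun (fun t ω => (ε t ω, ζ t ω, η t ω)) μ
  law : ∀ t, μ.map (fun ω => (ε t ω, ζ t ω, η t ω)) = M.πε.prod (M.πζ.prod M.πη)

/-- `G = lim (𝔼 ∏_{t=1}^n φ_t)^{1/n}`, all these expectations being finite. -/
structure HasGrowthRate {Ω : Type*} [MeasurableSpace Ω] (μ : Measure Ω)
    (φ : ℕ → Ω → ℝ≥0) (G : ℝ) : Prop where
  finite : ∀ n : ℕ, ∫⁻ ω, ∏ t ∈ Finset.Icc 1 n, (φ t ω : ℝ≥0∞) ∂μ ≠ ⊤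
  tendsto : Tendsto
    (fun n : ℕ => (∫⁻ ω, ∏ t ∈ Finset.Icc 1 n, (φ t ω : ℝ≥0∞) ∂μ).toReal ^ (1 / (n : ℝ)))
    atTop (𝓝 G)

/-- Extension of a consumption policy on `(0, ∞) × Z` to `[0, ∞) × Z` by `c (0, z) = 0`. -/
def extend {Z : Type*} (c : ℝ≥0 → Z → ℝ≥0) (a : ℝ≥0) (z : Z) : ℝ≥0 :=
  if 0 < a then c a z else 0

/-- Feasible policies: Borel measurable on `(0, ∞) × Z` with `0 ≤ c (a, z) ≤ a` there.
(Values of `c` at `a = 0` are never used. `Z` is finite and discrete, so measurability may be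
stated for each `z` separately.) -/
structure Feasible {Z : Type*} (c : ℝ≥0 → Z → ℝ≥0) : Prop where
  measurable : ∀ z, Measurable (fun a : Set.Ioi (0 : ℝ≥0) => c a z)
  le : ∀ a z, 0 < a → c a z ≤ a

theorem Feasible.measurable_extend {Z : Type*} [Fintype Z] [MeasurableSpace Z]
    [MeasurableSingletonClass Z] {c : ℝ≥0 → Z → ℝ≥0} (hc : Feasible c) :
    Measurable (fun x : ℝ≥0 × Z => extend c x.1 x.2) := by
  refine measurable_from_prod_countable_left fun z => ?_
  refine measurable_of_restrict_of_restrict_compl (s := Set.Ioi (0 : ℝ≥0)) measurableSet_Ioi ?_ ?_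
  · have h : (Set.Ioi (0 : ℝ≥0)).domRestrict (fun a => extend c a z) = fun a => c a.1 z := by
      funext a
      exact if_pos a.2
    exact h ▸ hc.measurable z
  · have h : (Set.Ioi (0 : ℝ≥0))ᶜ.domRestrict (fun a => extend c a z) = fun _ => 0 := by
      funext a
      exact if_neg a.2
    exact h ▸ measurable_const

namespace Primitives

variable {Z E₁ E₂ E₃ : Type*} [Fintype Z] [MeasurableSpace Z]
    [MeasurableSingletonClass Z] [MeasurableSpace E₁] [MeasurableSpace E₂]
    [MeasurableSpace E₃] (M : Primitives Z E₁ E₂ E₃)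

/-- The derivative `u'` on `(0, ∞)`. -/
def du (c : ℝ) : ℝ := deriv (fun x => (M.u x).toReal) c

/-- Marginal utility `u'` on `[0, ∞)`, with `u' 0 = ∞`. -/
def marginal (c : ℝ≥0) : ℝ≥0∞ := if c = 0 then ⊤ else ENNReal.ofReal (M.du c)

/-- The candidate class `𝒞` of continuous policies on `(0, ∞) × Z`, increasing in wealth, with
`0 < c (a, z) ≤ a` and `sup |u' (c (a, z)) - u' a| < ∞`. -/
structure IsCandidate (c : ℝ≥0 → Z → ℝ≥0) : Prop where
  continuousOn : ∀ z, ContinuousOn (fun a => c a z) (Set.Ioi 0)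
  monotoneOn : ∀ z, MonotoneOn (fun a => c a z) (Set.Ioi 0)
  pos : ∀ a z, 0 < a → 0 < c a z
  le : ∀ a z, 0 < a → c a z ≤ a
  bounded : ∃ K : ℝ, ∀ (a : ℝ≥0) (z : Z), 0 < a → |M.du (c a z) - M.du a| ≤ K

/-- The stochastic kernel `Q` of `(a_t, Z_t)` on `[0, ∞) × Z` under the policy `c`: from `(a, z)`
draw `z' ∼ P z`, `ζ ∼ πζ`, `η ∼ πη` independently and move to
`(R z' ζ * (a - c (a, z)) + Y z' η, z')`. -/
def Q {c : ℝ≥0 → Z → ℝ≥0} (hc : Feasible c) : Kernel (ℝ≥0 × Z) (ℝ≥0 × Z) where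
  toFun x := ((M.P x.2).toMeasure.prod (M.πζ.prod M.πη)).map fun w =>
    (M.R w.1 w.2.1 * (x.1 - extend c x.1 x.2) + M.Y w.1 w.2.2, w.1)
  measurable' := by
    have hR : Measurable (fun p : Z × E₂ => M.R p.1 p.2) :=
      measurable_from_prod_countable_right M.measurable_R
    have hY : Measurable (fun p : Z × E₃ => M.Y p.1 p.2) :=
      measurable_from_prod_countable_right M.measurable_Y
    let chain : Kernel Z Z := Kernel.ofFunOfCountable fun z => (M.P z).toMeasure
    have : IsMarkovKernel chain := ⟨fun z => inferInstanceAs (IsProbabilityMeasure (M.P z).toMeasure)⟩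
    let κ : Kernel (ℝ≥0 × Z) (Z × E₂ × E₃) :=
      (chain.comap Prod.snd measurable_snd) ×ₖ Kernel.const _ (M.πζ.prod M.πη)
    let f : (ℝ≥0 × Z) × Z × E₂ × E₃ → ℝ≥0 × Z := fun p =>
      (M.R p.2.1 p.2.2.1 * (p.1.1 - extend c p.1.1 p.1.2) + M.Y p.2.1 p.2.2.2, p.2.1)
    have hf : Measurable f := by
      have h1 := hR.comp (f := fun p : (ℝ≥0 × Z) × Z × E₂ × E₃ => (p.2.1, p.2.2.1)) (by fun_prop)
      have h2 := hY.comp (f := fun p : (ℝ≥0 × Z) × Z × E₂ × E₃ => (p.2.1, p.2.2.2)) (by fun_prop)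
      have h3 := hc.measurable_extend.comp
        (f := fun p : (ℝ≥0 × Z) × Z × E₂ × E₃ => p.1) (by fun_prop)
      exact ((h1.mul (measurable_fst.fst.sub h3)).add h2).prodMk (by fun_prop)
    convert ((Kernel.id ×ₖ κ).map f).measurable using 1
    funext x
    rw [Kernel.map_apply _ hf, Kernel.prod_apply, Kernel.id_apply, Kernel.prod_apply,
      Kernel.comap_apply, Kernel.const_apply, Measure.dirac_prod,
      Measure.map_map hf (by fun_prop)]
    rfl

end Primitives

namespace Shocks

variable {Z E₁ E₂ E₃ : Type*} [Fintype Z] [MeasurableSpace Z]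
    [MeasurableSingletonClass Z] [MeasurableSpace E₁] [MeasurableSpace E₂]
    [MeasurableSpace E₃] {M : Primitives Z E₁ E₂ E₃}
    {Ω : Type*} [MeasurableSpace Ω] {μ : Measure Ω} (S : Shocks M μ)

/-- The discount factor `β_t = β (Z_t, ε_t)` for `t ≥ 1` (`β_0 = 1` is built into
`discount`). -/
def beta (t : ℕ) (ω : Ω) : ℝ≥0 := M.β (S.chain t ω) (S.ε t ω)

/-- The gross return `R_t = R (Z_t, ζ_t)`. -/
def ret (t : ℕ) (ω : Ω) : ℝ≥0 := M.R (S.chain t ω) (S.ζ t ω)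

/-- Non-financial income `Y_t = Y (Z_t, η_t)`. -/
def income (t : ℕ) (ω : Ω) : ℝ≥0 := M.Y (S.chain t ω) (S.η t ω)

/-- `ℙ_z`, the probability conditional on `Z_0 = z`. -/
def condOn (z : Z) : Measure Ω := μ[|S.chain 0 ⁻¹' {z}]

/-- `β_0 β_1 ⋯ β_t` with `β_0 = 1`. -/
def discount (t : ℕ) (ω : Ω) : ℝ≥0 := ∏ i ∈ Finset.Icc 1 t, S.beta i ω

/-- The asset path generated by the policy `c` and `a_0 = a`. -/
def assets (c : ℝ≥0 → Z → ℝ≥0) (a : ℝ≥0) (t : ℕ) (ω : Ω) : ℝ≥0 :=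
  Nat.rec a (fun n x => S.ret (n + 1) ω * (x - extend c x (S.chain n ω)) + S.income (n + 1) ω) t

/-- Consumption `c_t = c (a_t, Z_t)` along the asset path. -/
def consumption (c : ℝ≥0 → Z → ℝ≥0) (a : ℝ≥0) (t : ℕ) (ω : Ω) : ℝ≥0 :=
  extend c (S.assets c a t ω) (S.chain t ω)

/-- Lifetime value `V_c (a, z) = 𝔼_{a,z} ∑_t β_0 ⋯ β_t u (c_t)` in `[-∞, ∞]`, the extended
expectation being the difference of the expected sums of positive and of negative parts. -/
def value (c : ℝ≥0 → Z → ℝ≥0) (a : ℝ≥0) (z : Z) : EReal :=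
  ((∫⁻ ω, ∑' t, (S.discount t ω : ℝ≥0∞) *
      (M.u (S.consumption c a t ω)).toENNReal ∂(S.condOn z) : ℝ≥0∞) : EReal) -
  ((∫⁻ ω, ∑' t, (S.discount t ω : ℝ≥0∞) *
      (-M.u (S.consumption c a t ω)).toENNReal ∂(S.condOn z) : ℝ≥0∞) : EReal)

/-- A policy is optimal if it is feasible and its lifetime value is at least that of every
feasible policy, at every initial state in `(0, ∞) × Z`. -/
def IsOptimal (c : ℝ≥0 → Z → ℝ≥0) : Prop :=
  Feasible c ∧ ∀ d : ℝ≥0 → Z → ℝ≥0, Feasible d →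
    ∀ (a : ℝ≥0) (z : Z), 0 < a → S.value d a z ≤ S.value c a z

/-- The linear-savings bound: `0 ≤ s < 1` and `𝔼_z β̂ R̂ u' (R̂ s a) ≤ u' a` on
`(0, ∞) × Z`, with `0 · ∞ = 0`. -/
def LinearSavingsBound (s : ℝ≥0) : Prop :=
  s < 1 ∧ ∀ (a : ℝ≥0) (z : Z), 0 < a →
    ∫⁻ ω, (S.beta 1 ω : ℝ≥0∞) * S.ret 1 ω * M.marginal (S.ret 1 ω * s * a) ∂(S.condOn z)
      ≤ M.marginal a

end Shocks

end IncomeFluctuation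

end

open IncomeFluctuation

/-! The growth conditions become conditions on the finite set `Z`. By the Markov property the mean
of `∏ φ_t` is an iterate of the nonnegative operator `transfer`, so the root test makes its Neumann
series `resolvent` finite (`resolvent_ne_top_of_growth`). Since `resolvent` equals its source plus
its own `transfer`, it is a Lyapunov weight: present values of wealth and of marginal utility of
income, and later the drift of wealth, are bounded by telescoping against it.

A candidate policy comes from time iteration. Given tomorrow's policy `c`, today's consumption `ξ`
solves `u'(ξ) = max (𝔼 β R u'(c'), u'(a))`. Starting from consuming everything, the iterates
decrease. Four properties survive both an iteration and a pointwise limit (`IsRegularPolicy`):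
consumption and savings increase in wealth, consumption lies between `(1 - s) a` and `a`, and `u' ∘
c` exceeds `u'` by at most `gapBound`. The first two make policies 1-Lipschitz and the last supplies
an integrable bound, so dominated convergence carries the Euler equation to the limit
(`exists_isEulerSol_self`).

Such a policy is optimal by a supporting-price argument. Consumption at each date is priced at
marginal utility along the path of `c`. Concavity bounds the utility difference to a rival by the
value difference at these prices; the Euler equation bounds the rival's total expenditure up to a
terminal term, and that term vanishes by transversality (`valuePos_add_valueNeg_le`). Positive and
negative parts of utility stay separate, so values of `-∞` cause no trouble. Strict concavity at
date 0 gives uniqueness.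

For stationarity, `c ≥ (1 - s) a` means savings are at most `s a`. As `s G_R < 1`, wealth weighted
by the resolvent of `s · meanR` satisfies a drift inequality with compact sublevel sets of wealth.
The kernel is Feller because `c` is continuous, and the Krylov–Bogoliubov argument applies
(`exists_invariant_of_drift`). -/

noncomputable section

namespace IncomeFluctuation

/-! ### One-step law and Markov property of the exogenous process -/

namespace Primitives

variable {Z E₁ E₂ E₃ : Type*} [Fintype Z] [MeasurableSpace Z]
    [MeasurableSingletonClass Z] [MeasurableSpace E₁] [MeasurableSpace E₂]
    [MeasurableSpace E₃] (M : Primitives Z E₁ E₂ E₃)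

/-- The joint law of one innovation triple. -/
def innovLaw : Measure (E₁ × E₂ × E₃) := M.πε.prod (M.πζ.prod M.πη)

instance : IsProbabilityMeasure M.innovLaw := by unfold innovLaw; infer_instance

/-- The one-step conditional expectation of `F (Z', ε', ζ', η')` given the current state `z`. -/
def step (F : Z → E₁ × E₂ × E₃ → ℝ≥0∞) (z : Z) : ℝ≥0∞ :=
  ∑ z', M.P z z' * ∫⁻ e, F z' e ∂M.innovLaw

lemma sum_P (z : Z) : ∑ z', M.P z z' = 1 := by
  rw [← tsum_fintype (L := .unconditional _)]
  exact (M.P z).tsum_coe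

lemma P_ne_top (z z' : Z) : M.P z z' ≠ ⊤ := (M.P z).apply_ne_top z'

end Primitives

namespace Shocks

variable {Z E₁ E₂ E₃ : Type*} [Fintype Z] [MeasurableSpace Z]
    [MeasurableSingletonClass Z] [MeasurableSpace E₁] [MeasurableSpace E₂]
    [MeasurableSpace E₃] {M : Primitives Z E₁ E₂ E₃}
    {Ω : Type*} [MeasurableSpace Ω] {μ : Measure Ω} (S : Shocks M μ)

/-- The innovation triple at time `t`. -/
def innov (t : ℕ) (ω : Ω) : E₁ × E₂ × E₃ := (S.ε t ω, S.ζ t ω, S.η t ω)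

lemma measurable_innov (t : ℕ) : Measurable (S.innov t) :=
  (S.measurable_ε t).prodMk ((S.measurable_ζ t).prodMk (S.measurable_η t))

/-- The path of the chain up to time `t`. -/
def chainPath (t : ℕ) (ω : Ω) : Finset.Iic t → Z := fun i => S.chain i ω

/-- The path of the innovations up to time `t`. -/
def innovPath (t : ℕ) (ω : Ω) : Finset.Iic t → E₁ × E₂ × E₃ := fun i => S.innov i ω

lemma measurable_chainPath (t : ℕ) : Measurable (S.chainPath t) :=
  measurable_pi_iff.2 fun i => S.measurable_chain i

lemma measurable_innovPath (t : ℕ) : Measurable (S.innovPath t) :=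
  measurable_pi_iff.2 fun i => S.measurable_innov i

/-- The information available at time `t`. -/
@[reducible]
def filt (t : ℕ) : MeasurableSpace Ω :=
  MeasurableSpace.comap (fun ω => (S.chainPath t ω, S.innovPath t ω)) inferInstance

lemma filt_le (t : ℕ) : S.filt t ≤ ‹MeasurableSpace Ω› :=
  ((S.measurable_chainPath t).prodMk (S.measurable_innovPath t)).comap_le

lemma measurable_filt_chain {t i : ℕ} (h : i ≤ t) : Measurable[S.filt t] (S.chain i) := by
  have h1 : Measurable fun p : (Finset.Iic t → Z) × (Finset.Iic t → E₁ × E₂ × E₃) =>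
      p.1 ⟨i, Finset.mem_Iic.2 h⟩ := by fun_prop
  exact h1.comp (comap_measurable _)

lemma measurable_filt_innov {t i : ℕ} (h : i ≤ t) : Measurable[S.filt t] (S.innov i) := by
  have h1 : Measurable fun p : (Finset.Iic t → Z) × (Finset.Iic t → E₁ × E₂ × E₃) =>
      p.2 ⟨i, Finset.mem_Iic.2 h⟩ := by fun_prop
  exact h1.comp (comap_measurable _)

lemma filt_mono {t t' : ℕ} (h : t ≤ t') : S.filt t ≤ S.filt t' := by
  refine Measurable.comap_le (m₁ := S.filt t') ?_
  refine Measurable.prodMk ?_ ?_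
  · exact @measurable_pi_lambda _ _ _ (S.filt t') _ _ fun i =>
      S.measurable_filt_chain ((Finset.mem_Iic.1 i.2).trans h)
  · exact @measurable_pi_lambda _ _ _ (S.filt t') _ _ fun i =>
      S.measurable_filt_innov ((Finset.mem_Iic.1 i.2).trans h)

lemma measure_chainPath_succ (t : ℕ) (p : Finset.Iic t → Z) (z' : Z) :
    μ (S.chainPath t ⁻¹' {p} ∩ S.chain (t + 1) ⁻¹' {z'}) =
      μ (S.chainPath t ⁻¹' {p}) * M.P (p ⟨t, by simp⟩) z' := by
  -- The field `markov` speaks of infinite sequences, so `p` is continued by the constant `z'`; only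
  -- its value at `t + 1` matters.
  let z : ℕ → Z := fun n => if h : n ≤ t then p ⟨n, Finset.mem_Iic.2 h⟩ else z'
  have h1 : S.chainPath t ⁻¹' {p} = {ω | ∀ i ≤ t, S.chain i ω = z i} := by
    ext ω
    simp only [Set.mem_preimage, Set.mem_singleton_iff, funext_iff, Subtype.forall,
      Finset.mem_Iic, Set.mem_ofPred_eq, chainPath]
    refine forall₂_congr fun i hi => ?_
    simp [z, hi]
  have h2 : S.chainPath t ⁻¹' {p} ∩ S.chain (t + 1) ⁻¹' {z'} =
      {ω | ∀ i ≤ t + 1, S.chain i ω = z i} := by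
    rw [h1]
    ext ω
    simp only [Set.mem_inter_iff, Set.mem_ofPred_eq, Set.mem_preimage, Set.mem_singleton_iff]
    constructor
    · rintro ⟨ha, hb⟩ i hi
      rcases Nat.le_succ_iff.1 hi with h | rfl
      · exact ha i h
      · simp [z, hb]
    · intro h
      refine ⟨fun i hi => h i (hi.trans t.le_succ), ?_⟩
      simpa [z] using h (t + 1) le_rfl
  rw [h2, h1, S.markov t z]
  simp [z]

/-- Three sources of factorization combine: the chain is independent of all innovations, the
innovation at `t + 1` is independent of earlier ones, and the chain itself is Markov. -/
lemma measure_rect [IsProbabilityMeasure μ] (t : ℕ) (p : Finset.Iic t → Z) (z' : Z)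
    {B : Set (Finset.Iic t → E₁ × E₂ × E₃)} (hB : MeasurableSet B)
    {C : Set (E₁ × E₂ × E₃)} (hC : MeasurableSet C) :
    μ ((S.chainPath t ⁻¹' {p} ∩ S.chain (t + 1) ⁻¹' {z'}) ∩
        (S.innovPath t ⁻¹' B ∩ S.innov (t + 1) ⁻¹' C)) =
      μ (S.chainPath t ⁻¹' {p}) * M.P (p ⟨t, by simp⟩) z' *
        (μ (S.innovPath t ⁻¹' B) * M.innovLaw C) := by
  have hind : IndepFun (S.innovPath t) (S.innov (t + 1)) μ := by
    have h := S.indep_time.indepFun_finset (Finset.Iic t) {t + 1} (by simp)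
      (fun i => S.measurable_innov i)
    have h2 : Measurable fun f : ({t + 1} : Finset ℕ) → E₁ × E₂ × E₃ =>
      f ⟨t + 1, by simp⟩ := by fun_prop
    exact h.comp measurable_id h2
  have h1 : μ (S.innovPath t ⁻¹' B ∩ S.innov (t + 1) ⁻¹' C) =
      μ (S.innovPath t ⁻¹' B) * M.innovLaw C := by
    rw [hind.measure_inter_preimage_eq_mul _ _ hB hC]
    congr 1
    rw [← Measure.map_apply (S.measurable_innov _) hC]
    congr 1
    exact S.law (t + 1)
  rw [← h1, ← measure_chainPath_succ]
  -- `indep_chain` concerns entire trajectories, so both events are written as events in trajectory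
  -- space.
  let U : Set (ℕ → Z) := {x | (fun i : Finset.Iic t => x i) = p ∧ x (t + 1) = z'}
  let V : Set (ℕ → E₁ × E₂ × E₃) := {x | (fun i : Finset.Iic t => x i) ∈ B ∧ x (t + 1) ∈ C}
  have hU : MeasurableSet U := by
    refine MeasurableSet.inter ?_ ?_
    · exact (by fun_prop : Measurable fun (x : ℕ → Z) (i : Finset.Iic t) => x i)
        (measurableSet_singleton p)
    · exact (by fun_prop : Measurable fun x : ℕ → Z => x (t + 1)) (measurableSet_singleton z')
  have hV : MeasurableSet V := by
    refine MeasurableSet.inter ?_ ?_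
    · exact (by fun_prop : Measurable fun (x : ℕ → E₁ × E₂ × E₃) (i : Finset.Iic t) => x i) hB
    · exact (by fun_prop : Measurable fun x : ℕ → E₁ × E₂ × E₃ => x (t + 1)) hC
  exact S.indep_chain.measure_inter_preimage_eq_mul _ _ hU hV

/-- There are finitely many chain paths up to `t`. On each of them an event of `filt t` is a section
in the innovations alone, so the rectangle formula applies path by path, without a π-λ argument. -/
lemma measure_inter_next [IsProbabilityMeasure μ] (t : ℕ) (z' : Z)
    {A : Set Ω} (hA : MeasurableSet[S.filt t] A) {C : Set (E₁ × E₂ × E₃)} (hC : MeasurableSet C) :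
    μ (A ∩ S.chain (t + 1) ⁻¹' {z'} ∩ S.innov (t + 1) ⁻¹' C) =
      (∫⁻ ω in A, M.P (S.chain t ω) z' ∂μ) * M.innovLaw C := by
  obtain ⟨D, hD, rfl⟩ := hA
  have hsum (ν : Measure Ω) : ∑ p, ν (S.chainPath t ⁻¹' {p}) = ν Set.univ := by
    rw [sum_measure_preimage_singleton _
      (fun p _ => S.measurable_chainPath t (measurableSet_singleton p))]
    simp
  have hA' := ((S.measurable_chainPath t).prodMk (S.measurable_innovPath t)) hD
  have hZ := S.measurable_chain (t + 1) (measurableSet_singleton z')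
  have hI := S.measurable_innov (t + 1) hC
  set A := (fun ω => (S.chainPath t ω, S.innovPath t ω)) ⁻¹' D with hAdef
  let B : (Finset.Iic t → Z) → Set (Finset.Iic t → E₁ × E₂ × E₃) := fun p => Prod.mk p ⁻¹' D
  have hB p : MeasurableSet (B p) := measurable_prodMk_left hD
  have hAB p : S.chainPath t ⁻¹' {p} ∩ A = S.chainPath t ⁻¹' {p} ∩ S.innovPath t ⁻¹' B p := by
    ext ω
    simp only [Set.mem_inter_iff, Set.mem_preimage, Set.mem_singleton_iff, hAdef, B]
    constructor
    · rintro ⟨rfl, h⟩; exact ⟨rfl, h⟩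
    · rintro ⟨rfl, h⟩; exact ⟨rfl, h⟩
  have hP : Measurable fun ω => M.P (S.chain t ω) z' :=
    (measurable_of_finite fun z => M.P z z').comp (S.measurable_chain t)
  have hleft := hsum (μ.restrict (A ∩ S.chain (t + 1) ⁻¹' {z'} ∩ S.innov (t + 1) ⁻¹' C))
  rw [Measure.restrict_apply_univ] at hleft
  have hright := hsum ((μ.restrict A).withDensity fun ω => M.P (S.chain t ω) z')
  rw [withDensity_apply _ .univ, Measure.restrict_univ] at hright
  rw [← hleft, ← hright, Finset.sum_mul]
  refine Finset.sum_congr rfl fun p _ => ?_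
  have hp := S.measurable_chainPath t (measurableSet_singleton p)
  rw [Measure.restrict_apply hp, withDensity_apply _ hp, Measure.restrict_restrict hp, hAB]
  have h1 : S.chainPath t ⁻¹' {p} ∩ (A ∩ S.chain (t + 1) ⁻¹' {z'} ∩ S.innov (t + 1) ⁻¹' C) =
      (S.chainPath t ⁻¹' {p} ∩ S.chain (t + 1) ⁻¹' {z'}) ∩
        (S.innovPath t ⁻¹' B p ∩ S.innov (t + 1) ⁻¹' C) := by
    rw [← Set.inter_assoc, ← Set.inter_assoc, hAB, Set.inter_right_comm _ _ (_ ⁻¹' {z'}),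
      Set.inter_assoc _ _ (_ ⁻¹' C)]
  rw [h1, S.measure_rect t p z' (hB p) hC]
  have h2 : ∫⁻ ω in S.chainPath t ⁻¹' {p} ∩ S.innovPath t ⁻¹' B p, M.P (S.chain t ω) z' ∂μ =
      ∫⁻ ω in S.chainPath t ⁻¹' {p} ∩ S.innovPath t ⁻¹' B p, M.P (p ⟨t, by simp⟩) z' ∂μ := by
    refine setLIntegral_congr_fun (hp.inter (S.measurable_innovPath t (hB p))) fun ω hω => ?_
    obtain ⟨h, -⟩ := hω
    simp only [Set.mem_preimage, Set.mem_singleton_iff] at h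
    rw [← h]
    rfl
  rw [h2, setLIntegral_const]
  -- Independence of the two pasts is recovered by summing the rectangle formula with `C = univ`
  -- over all next states.
  have h3 : μ (S.chainPath t ⁻¹' {p} ∩ S.innovPath t ⁻¹' B p) =
      μ (S.chainPath t ⁻¹' {p}) * μ (S.innovPath t ⁻¹' B p) := by
    have h4 := fun z => S.measure_rect t p z (hB p) MeasurableSet.univ
    have h5 : ∑ z, (μ.restrict (S.chainPath t ⁻¹' {p} ∩ S.innovPath t ⁻¹' B p))
        (S.chain (t + 1) ⁻¹' {z}) = μ (S.chainPath t ⁻¹' {p} ∩ S.innovPath t ⁻¹' B p) := by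
      rw [sum_measure_preimage_singleton _
        (fun p _ => S.measurable_chain (t + 1) (measurableSet_singleton p))]
      simp
    rw [← h5]
    have h6 z : (μ.restrict (S.chainPath t ⁻¹' {p} ∩ S.innovPath t ⁻¹' B p))
        (S.chain (t + 1) ⁻¹' {z}) = μ (S.chainPath t ⁻¹' {p}) * M.P (p ⟨t, by simp⟩) z *
        (μ (S.innovPath t ⁻¹' B p)) := by
      rw [Measure.restrict_apply (S.measurable_chain (t + 1) (measurableSet_singleton z))]
      have := h4 z
      simp only [Set.preimage_univ, Set.inter_univ, measure_univ, mul_one] at this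
      rw [← this]
      congr 1
      ext ω
      simp only [Set.mem_inter_iff]
      tauto
    simp_rw [h6]
    rw [← Finset.sum_mul, ← Finset.mul_sum, M.sum_P, mul_one]
  rw [h3]
  ring

/-- The joint law of `H` and the next innovation on `{Z_{t+1} = z'}` is a product measure, because
it agrees with one on rectangles. Tonelli then integrates the innovation out. -/
lemma setLIntegral_next [IsProbabilityMeasure μ] {T : Type*} [MeasurableSpace T] (t : ℕ) (z' : Z)
    {H : Ω → T} (hH : Measurable[S.filt t] H) {G : T × (E₁ × E₂ × E₃) → ℝ≥0∞}
    (hG : Measurable G) :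
    ∫⁻ ω in S.chain (t + 1) ⁻¹' {z'}, G (H ω, S.innov (t + 1) ω) ∂μ =
      ∫⁻ ω, M.P (S.chain t ω) z' * ∫⁻ e, G (H ω, e) ∂M.innovLaw ∂μ := by
  have hH' : Measurable H := hH.mono (S.filt_le t) le_rfl
  have hP : Measurable fun ω => M.P (S.chain t ω) z' :=
    (measurable_of_finite fun z => M.P z z').comp (S.measurable_chain t)
  have hZ := S.measurable_chain (t + 1) (measurableSet_singleton z')
  let ν : Measure T := (μ.withDensity fun ω => M.P (S.chain t ω) z').map H
  have hfin : IsFiniteMeasure (μ.withDensity fun ω => M.P (S.chain t ω) z') := by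
    refine isFiniteMeasure_withDensity (ne_top_of_le_ne_top (b := 1) (by simp) ?_)
    calc ∫⁻ ω, M.P (S.chain t ω) z' ∂μ ≤ ∫⁻ ω, 1 ∂μ := lintegral_mono fun ω => PMF.coe_le_one _ _
      _ = 1 := by simp
  have key : ν.prod M.innovLaw =
      (μ.restrict (S.chain (t + 1) ⁻¹' {z'})).map fun ω => (H ω, S.innov (t + 1) ω) := by
    refine Measure.prod_eq fun s C hs hC => ?_
    rw [Measure.map_apply (hH'.prodMk (S.measurable_innov _)) (hs.prod hC),
      Measure.restrict_apply (hH'.prodMk (S.measurable_innov _) (hs.prod hC)),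
      Measure.map_apply hH' hs, withDensity_apply _ (hH' hs),
      ← S.measure_inter_next t z' (hH hs) hC]
    congr 1
    ext ω
    simp only [Set.mem_inter_iff, Set.mem_preimage, Set.mem_prod]
    tauto
  calc ∫⁻ ω in S.chain (t + 1) ⁻¹' {z'}, G (H ω, S.innov (t + 1) ω) ∂μ
      = ∫⁻ p, G p ∂(ν.prod M.innovLaw) := by
        rw [key, lintegral_map hG (hH'.prodMk (S.measurable_innov _))]
    _ = ∫⁻ x, ∫⁻ e, G (x, e) ∂M.innovLaw ∂ν := lintegral_prod _ hG.aemeasurable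
    _ = _ := by
        rw [lintegral_map hG.lintegral_prod_right' hH']
        exact lintegral_withDensity_eq_lintegral_mul _ hP (hG.lintegral_prod_right'.comp hH')

/-- The Markov property of the exogenous process. -/
lemma lintegral_next [IsProbabilityMeasure μ] {T : Type*} [MeasurableSpace T] (t : ℕ)
    {H : Ω → T} (hH : Measurable[S.filt t] H) {F : T → Z → E₁ × E₂ × E₃ → ℝ≥0∞}
    (hF : ∀ z, Measurable fun p : T × (E₁ × E₂ × E₃) => F p.1 z p.2) :
    ∫⁻ ω, F (H ω) (S.chain (t + 1) ω) (S.innov (t + 1) ω) ∂μ =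
      ∫⁻ ω, M.step (F (H ω)) (S.chain t ω) ∂μ := by
  have hH' : Measurable H := hH.mono (S.filt_le t) le_rfl
  have hZ z' := S.measurable_chain (t + 1) (measurableSet_singleton z')
  have h1 ω : F (H ω) (S.chain (t + 1) ω) (S.innov (t + 1) ω) =
      ∑ z', (S.chain (t + 1) ⁻¹' {z'}).indicator (fun ω => F (H ω) z' (S.innov (t + 1) ω)) ω := by
    classical
    rw [Finset.sum_eq_single (S.chain (t + 1) ω)]
    · simp
    · intro b _ hb
      exact Set.indicator_of_notMem (by simpa using hb.symm) _
    · simp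
  have hm z' : Measurable fun ω => F (H ω) z' (S.innov (t + 1) ω) :=
    (hF z').comp (hH'.prodMk (S.measurable_innov _))
  simp_rw [h1, Primitives.step]
  rw [lintegral_finsetSum _ fun z' _ => (hm z').indicator (hZ z'), lintegral_finsetSum]
  · refine Finset.sum_congr rfl fun z' _ => ?_
    rw [lintegral_indicator (hZ z')]
    exact S.setLIntegral_next t z' hH (hF z')
  · intro z' _
    refine Measurable.mul ?_ ?_
    · exact (measurable_of_finite fun z => M.P z z').comp (S.measurable_chain t)
    · exact (hF z').lintegral_prod_right'.comp hH'

lemma lintegral_condOn (z : Z) (f : Ω → ℝ≥0∞) :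
    ∫⁻ ω, f ω ∂S.condOn z =
      (μ (S.chain 0 ⁻¹' {z}))⁻¹ * ∫⁻ ω, (S.chain 0 ⁻¹' {z}).indicator f ω ∂μ := by
  rw [condOn, ProbabilityTheory.cond, lintegral_smul_measure, smul_eq_mul,
    lintegral_indicator (S.measurable_chain 0 (measurableSet_singleton z))]

/-- The Markov property of the exogenous process, conditional on `Z_0 = z`. -/
lemma lintegral_condOn_next [IsProbabilityMeasure μ] {T : Type*} [MeasurableSpace T] (z : Z)
    (t : ℕ) {H : Ω → T} (hH : Measurable[S.filt t] H) {F : T → Z → E₁ × E₂ × E₃ → ℝ≥0∞}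
    (hF : ∀ z, Measurable fun p : T × (E₁ × E₂ × E₃) => F p.1 z p.2) :
    ∫⁻ ω, F (H ω) (S.chain (t + 1) ω) (S.innov (t + 1) ω) ∂S.condOn z =
      ∫⁻ ω, M.step (F (H ω)) (S.chain t ω) ∂S.condOn z := by
  classical
  rw [lintegral_condOn, lintegral_condOn]
  congr 1
  -- The conditioning event is known at time `t`: `Z_0` is carried as an extra coordinate of `H`,
  -- and the integrand vanishes unless it equals `z`.
  have h := S.lintegral_next t (T := T × Z) (hH.prodMk (S.measurable_filt_chain (Nat.zero_le t)))
    (F := fun p z' e => if p.2 = z then F p.1 z' e else 0) ?_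
  · refine Eq.trans ?_ (h.trans ?_)
    · refine lintegral_congr fun ω => ?_
      by_cases h0 : S.chain 0 ω = z
      · rw [Set.indicator_of_mem (by simpa using h0)]; simp [h0]
      · rw [Set.indicator_of_notMem (by simpa using h0)]; simp [h0]
    · refine lintegral_congr fun ω => ?_
      by_cases h0 : S.chain 0 ω = z
      · rw [Set.indicator_of_mem (by simpa using h0)]; simp [h0]
      · rw [Set.indicator_of_notMem (by simpa using h0)]; simp [h0, Primitives.step]
  · intro z'
    refine Measurable.ite ?_ ?_ measurable_const
    · exact (by fun_prop : Measurable fun p : (T × Z) × E₁ × E₂ × E₃ => p.1.2)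
        (measurableSet_singleton z)
    · exact (hF z').comp (by fun_prop : Measurable fun p : (T × Z) × E₁ × E₂ × E₃ => (p.1.1, p.2))

/-- Every state has positive probability under the stationary chain. -/
lemma measure_chain_zero_ne_zero [IsProbabilityMeasure μ] (z : Z) :
    μ (S.chain 0 ⁻¹' {z}) ≠ 0 := by
  have hsum : ∑ z, μ (S.chain 0 ⁻¹' {z}) = 1 := by
    rw [sum_measure_preimage_singleton _
      (fun p _ => S.measurable_chain 0 (measurableSet_singleton p))]
    simp
  obtain ⟨x, hx⟩ : ∃ x, μ (S.chain 0 ⁻¹' {x}) ≠ 0 := by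
    by_contra! h
    simp [h] at hsum
  have hstep {x y : Z} (hx : μ (S.chain 0 ⁻¹' {x}) ≠ 0) (hxy : M.P x y ≠ 0) :
      μ (S.chain 0 ⁻¹' {y}) ≠ 0 := by
    intro h
    have h1 : ∑ z, μ (S.chain 0 ⁻¹' {z}) * M.P z y = 0 := (S.stationary y).trans h
    exact mul_ne_zero hx hxy ((Finset.sum_eq_zero_iff.1 h1) x (Finset.mem_univ x))
  induction M.irreducible x z with
  | refl => exact hx
  | tail _ h ih => exact hstep ih h

instance isProbabilityMeasure_condOn [IsProbabilityMeasure μ] (z : Z) :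
    IsProbabilityMeasure (S.condOn z) :=
  cond_isProbabilityMeasure (S.measure_chain_zero_ne_zero z)

lemma condOn_chain_zero (z : Z) : ∀ᵐ ω ∂S.condOn z, S.chain 0 ω = z := by
  have := ae_cond_mem (μ := μ) (S.measurable_chain 0 (measurableSet_singleton z))
  simpa [condOn] using this

/-- Every state has a predecessor. -/
lemma exists_P_ne_zero [IsProbabilityMeasure μ] (S : Shocks M μ) (z' : Z) : ∃ z, M.P z z' ≠ 0 := by
  by_contra! h
  have h1 : ∑ z, μ (S.chain 0 ⁻¹' {z}) * M.P z z' = μ (S.chain 0 ⁻¹' {z'}) := S.stationary z'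
  exact S.measure_chain_zero_ne_zero z' (by simp [← h1, h])

end Shocks

/-! ### Weighted transition operators and their Neumann series -/

namespace Primitives

variable {Z E₁ E₂ E₃ : Type*} [Fintype Z] [MeasurableSpace Z]
    [MeasurableSingletonClass Z] [MeasurableSpace E₁] [MeasurableSpace E₂]
    [MeasurableSpace E₃] (M : Primitives Z E₁ E₂ E₃)

lemma lintegral_innovLaw_mul {f : E₁ → ℝ≥0∞} {g : E₂ → ℝ≥0∞} {h : E₃ → ℝ≥0∞}
    (hf : Measurable f) (hg : Measurable g) (hh : Measurable h) :
    ∫⁻ e, f e.1 * g e.2.1 * h e.2.2 ∂M.innovLaw =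
      (∫⁻ x, f x ∂M.πε) * (∫⁻ x, g x ∂M.πζ) * ∫⁻ x, h x ∂M.πη := by
  simp_rw [mul_assoc]
  rw [innovLaw, lintegral_prod_mul (f := f) (g := fun p : E₂ × E₃ => g p.1 * h p.2)
    hf.aemeasurable (by fun_prop), lintegral_prod_mul hg.aemeasurable hh.aemeasurable]

/-- The weighted transition operator `w ↦ (z ↦ ∑ z', P z z' g z' w z')`. -/
def transfer (g w : Z → ℝ≥0∞) (z : Z) : ℝ≥0∞ := ∑ z', M.P z z' * (g z' * w z')

lemma transfer_mono (g : Z → ℝ≥0∞) {w w' : Z → ℝ≥0∞} (h : w ≤ w') :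
    M.transfer g w ≤ M.transfer g w' := fun _ => by
  unfold transfer
  gcongr with z' _
  exact h z'

lemma transfer_const_mul (g : Z → ℝ≥0∞) (C : ℝ≥0∞) (w : Z → ℝ≥0∞) :
    M.transfer g (fun z => C * w z) = fun z => C * M.transfer g w z := by
  funext z
  simp only [transfer, Finset.mul_sum]
  exact Finset.sum_congr rfl fun z' _ => by ring

lemma transfer_ne_top {g w : Z → ℝ≥0∞} (hg : ∀ z, g z ≠ ⊤) (hw : ∀ z, w z ≠ ⊤) (z : Z) :
    M.transfer g w z ≠ ⊤ :=
  ENNReal.sum_ne_top.2 fun z' _ =>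
    ENNReal.mul_ne_top (M.P_ne_top z z') (ENNReal.mul_ne_top (hg z') (hw z'))

lemma step_mul (φ : Z → E₁ × E₂ × E₃ → ℝ≥0∞) (hφ : ∀ z, Measurable (φ z)) (w : Z → ℝ≥0∞)
    (C : ℝ≥0∞) (z : Z) :
    M.step (fun z' e => C * (φ z' e * w z')) z =
      C * M.transfer (fun z' => ∫⁻ e, φ z' e ∂M.innovLaw) w z := by
  simp only [step, transfer, Finset.mul_sum]
  refine Finset.sum_congr rfl fun z' _ => ?_
  rw [lintegral_const_mul _ ((hφ z').mul_const _), lintegral_mul_const _ (hφ z')]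
  ring

/-- The Neumann series `∑ n, (transfer g)^n f`. -/
def resolvent (g f : Z → ℝ≥0∞) (z : Z) : ℝ≥0∞ := ∑' n, (M.transfer g)^[n] f z

/-- Splitting off the zeroth term of the series; no finiteness is needed in `ℝ≥0∞`. This identity is
what makes `resolvent` a Lyapunov weight. -/
lemma resolvent_eq (g f : Z → ℝ≥0∞) (z : Z) :
    M.resolvent g f z = f z + M.transfer g (M.resolvent g f) z := by
  rw [resolvent, tsum_eq_zero_add' ENNReal.summable]
  congr 1
  simp_rw [Function.iterate_succ_apply']
  simp only [transfer, resolvent]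
  rw [Summable.tsum_finsetSum fun _ _ => ENNReal.summable]
  simp_rw [ENNReal.tsum_mul_left]

/-- On a finite set `f` is dominated by the constant `∑ z, f z`, and the operator is monotone and
homogeneous. -/
lemma resolvent_ne_top {g f : Z → ℝ≥0∞} (hg : ∀ z, M.resolvent g 1 z ≠ ⊤)
    (hf : ∀ z, f z ≠ ⊤) (z : Z) : M.resolvent g f z ≠ ⊤ := by
  let C := ∑ z, f z
  have hC : C ≠ ⊤ := ENNReal.sum_ne_top.2 fun z _ => hf z
  have hmono n : ∀ w w' : Z → ℝ≥0∞, w ≤ w' → (M.transfer g)^[n] w ≤ (M.transfer g)^[n] w' :=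
    fun w w' h => Monotone.iterate (fun _ _ h => M.transfer_mono g h) n h
  have hC' n : (M.transfer g)^[n] (fun z => C * 1) = fun z => C * (M.transfer g)^[n] 1 z := by
    induction n with
    | zero => rfl
    | succ n ih => rw [Function.iterate_succ_apply', ih, transfer_const_mul,
        Function.iterate_succ_apply']
  have h1 : M.resolvent g f z ≤ C * M.resolvent g 1 z := by
    rw [resolvent, resolvent, ← ENNReal.tsum_mul_left]
    refine ENNReal.tsum_le_tsum fun n => ?_
    have h2 := hmono n f (fun z => C * 1) (fun z => by
      rw [mul_one]
      exact Finset.single_le_sum (f := f) (fun _ _ => zero_le) (Finset.mem_univ z)) z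
    rw [hC'] at h2
    exact h2
  exact ne_top_of_le_ne_top (ENNReal.mul_ne_top hC (hg z)) h1

end Primitives

/-! ### From growth rates to finite resolvents -/

namespace Shocks

variable {Z E₁ E₂ E₃ : Type*} [Fintype Z] [MeasurableSpace Z]
    [MeasurableSingletonClass Z] [MeasurableSpace E₁] [MeasurableSpace E₂]
    [MeasurableSpace E₃] {M : Primitives Z E₁ E₂ E₃}
    {Ω : Type*} [MeasurableSpace Ω] {μ : Measure Ω} (S : Shocks M μ)

lemma measurable_filt_comp {t i : ℕ} (h : i ≤ t) {φ : Z → E₁ × E₂ × E₃ → ℝ≥0∞}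
    (hφ : ∀ z, Measurable (φ z)) :
    Measurable[S.filt t] fun ω => φ (S.chain i ω) (S.innov i ω) := by
  have h1 : Measurable fun p : Z × (E₁ × E₂ × E₃) => φ p.1 p.2 :=
    measurable_from_prod_countable_right hφ
  exact h1.comp ((S.measurable_filt_chain h).prodMk (S.measurable_filt_innov h))

/-- Conditioning on time `n` absorbs the last factor into the terminal weight, replacing `w` by its
transfer; hence the induction over arbitrary `w`. -/
lemma lintegral_prod_transfer [IsProbabilityMeasure μ] {φ : Z → E₁ × E₂ × E₃ → ℝ≥0∞}
    (hφ : ∀ z, Measurable (φ z)) (n : ℕ) (w : Z → ℝ≥0∞) :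
    ∫⁻ ω, (∏ t ∈ Finset.Icc 1 n, φ (S.chain t ω) (S.innov t ω)) * w (S.chain n ω) ∂μ =
      ∫⁻ ω, (M.transfer fun z => ∫⁻ e, φ z e ∂M.innovLaw)^[n] w (S.chain 0 ω) ∂μ := by
  induction n generalizing w with
  | zero => simp
  | succ n ih =>
    rw [Function.iterate_succ_apply, ← ih]
    simp_rw [Finset.prod_Icc_succ_top (Nat.le_add_left 1 n)]
    have hH : Measurable[S.filt n] fun ω =>
        ∏ t ∈ Finset.Icc 1 n, φ (S.chain t ω) (S.innov t ω) :=
      Finset.measurable_fun_prod _ fun i hi =>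
        S.measurable_filt_comp (Finset.mem_Icc.1 hi).2 hφ
    have h := S.lintegral_next n hH (F := fun h z' e => h * (φ z' e * w z')) fun z =>
      measurable_fst.mul (((hφ z).comp measurable_snd).mul_const _)
    simp_rw [M.step_mul φ hφ w] at h
    rw [← h]
    simp_rw [mul_assoc]

lemma lintegral_chain_zero (w : Z → ℝ≥0∞) :
    ∫⁻ ω, w (S.chain 0 ω) ∂μ = ∑ z, w z * μ (S.chain 0 ⁻¹' {z}) := by
  rw [← lintegral_map (measurable_of_finite w) (S.measurable_chain 0), lintegral_fintype]
  refine Finset.sum_congr rfl fun z _ => ?_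
  rw [Measure.map_apply (S.measurable_chain 0) (measurableSet_singleton z)]

/-- A function of the current exogenous state with finite stationary mean has finite mean
conditional on every value of the chain. -/
lemma lintegral_innovLaw_ne_top [IsProbabilityMeasure μ] {φ : Z → E₁ × E₂ × E₃ → ℝ≥0∞}
    (hφ : ∀ z, Measurable (φ z)) (h : ∫⁻ ω, φ (S.chain 1 ω) (S.innov 1 ω) ∂μ ≠ ⊤) (z' : Z) :
    ∫⁻ e, φ z' e ∂M.innovLaw ≠ ⊤ := by
  have h1 := S.lintegral_prod_transfer hφ 1 1
  simp only [Finset.Icc_self, Finset.prod_singleton, Pi.one_apply, mul_one,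
    Function.iterate_one] at h1
  rw [h1, S.lintegral_chain_zero, ENNReal.sum_ne_top] at h
  obtain ⟨z, hz⟩ := S.exists_P_ne_zero z'
  intro htop
  have h2 : M.transfer (fun z => ∫⁻ e, φ z e ∂M.innovLaw) 1 z = ⊤ := by
    by_contra h3
    exact ENNReal.sum_ne_top.1 h3 z' (Finset.mem_univ _)
      (by simp [htop, hz])
  exact h z (Finset.mem_univ z)
    (by rw [h2]; exact ENNReal.top_mul (S.measure_chain_zero_ne_zero z))

/-- Root test: `∑ s ^ n 𝔼 ∏ φ_t` converges. It is also the stationary average of the Neumann series,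
and since every state has positive stationary mass, the series is finite at each state. The factor
`s` serves the condition `s G_R < 1`; the other uses take `s = 1`. -/
lemma resolvent_ne_top_of_growth [IsProbabilityMeasure μ] {φ : Z → E₁ × E₂ × E₃ → ℝ≥0}
    (hφ : ∀ z, Measurable (φ z)) {G : ℝ}
    (hG : HasGrowthRate μ (fun t ω => φ (S.chain t ω) (S.innov t ω)) G)
    (s : ℝ≥0) (hs : s * G < 1) (z : Z) :
    M.resolvent (fun z => s * ∫⁻ e, (φ z e : ℝ≥0∞) ∂M.innovLaw) 1 z ≠ ⊤ := by
  let x : ℕ → ℝ≥0∞ := fun n =>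
    ∫⁻ ω, ∏ t ∈ Finset.Icc 1 n, (φ (S.chain t ω) (S.innov t ω) : ℝ≥0∞) ∂μ
  have hx n : x n ≠ ⊤ := hG.finite n
  have hm z : Measurable fun e => (φ z e : ℝ≥0∞) := (hφ z).coe_nnreal_ennreal
  have hsum : ∑' n, (s : ℝ≥0∞) ^ n * x n ≠ ⊤ := by
    obtain ⟨ρ, hρ, hρ1⟩ := exists_between (max_lt hs one_pos)
    have hρ0 : 0 < ρ := (le_max_right _ _).trans_lt hρ
    have hev : ∀ᶠ n : ℕ in atTop, s * (x n).toReal ^ (1 / (n : ℝ)) < ρ :=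
      (hG.tendsto.const_mul (s : ℝ)).eventually_lt_const ((le_max_left _ _).trans_lt hρ)
    have hsummable : Summable fun n => ((s : ℝ≥0∞) ^ n * x n).toReal := by
      refine Summable.of_norm_bounded_eventually_nat
        (summable_geometric_of_lt_one hρ0.le hρ1) ?_
      -- `n = 0` is excluded because the exponent `1 / n` is then `0` and the `n`-th root cannot be
      -- undone.
      filter_upwards [hev, eventually_ne_atTop 0] with n hn hn0
      rw [Real.norm_of_nonneg ENNReal.toReal_nonneg, ENNReal.toReal_mul, ENNReal.toReal_pow,
        ENNReal.coe_toReal]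
      calc (s : ℝ) ^ n * (x n).toReal = (s * (x n).toReal ^ (1 / (n : ℝ))) ^ n := by
            rw [mul_pow, one_div, Real.rpow_inv_natCast_pow ENNReal.toReal_nonneg hn0]
        _ ≤ ρ ^ n := by gcongr
    refine (tsum_congr fun n => ?_).trans_ne hsummable.tsum_ofReal_ne_top
    exact (ENNReal.ofReal_toReal (ENNReal.mul_ne_top (ENNReal.pow_ne_top ENNReal.coe_ne_top)
      (hx n))).symm
  have hprod n : (s : ℝ≥0∞) ^ n * x n = ∑ z,
      (M.transfer fun z => s * ∫⁻ e, (φ z e : ℝ≥0∞) ∂M.innovLaw)^[n] 1 z *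
        μ (S.chain 0 ⁻¹' {z}) := by
    have h1 := S.lintegral_prod_transfer (φ := fun z e => s * (φ z e : ℝ≥0∞))
      (fun z => (hm z).const_mul _) n 1
    have h3 z := lintegral_const_mul (μ := M.innovLaw) (s : ℝ≥0∞) (hm z)
    simp only [h3] at h1
    rw [← S.lintegral_chain_zero, ← h1]
    simp only [Pi.one_apply, mul_one, Finset.prod_mul_distrib, Finset.prod_const,
      Nat.card_Icc, add_tsub_cancel_right]
    rw [lintegral_const_mul]
    exact Finset.measurable_fun_prod _ fun i hi =>
      (S.measurable_filt_comp le_rfl hm).mono (S.filt_le i) le_rfl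
  simp_rw [hprod] at hsum
  rw [Summable.tsum_finsetSum fun _ _ => ENNReal.summable, ENNReal.sum_ne_top] at hsum
  have h2 := hsum z (Finset.mem_univ z)
  rw [ENNReal.tsum_mul_right] at h2
  intro htop
  exact h2 (by
    rw [← Primitives.resolvent, htop]
    exact ENNReal.top_mul (S.measure_chain_zero_ne_zero z))

end Shocks

/-! ### Concave utility, marginal utility and tangent inequalities -/

lemma EReal_toENNReal_eq_zero_or (x : EReal) : x.toENNReal = 0 ∨ (-x).toENNReal = 0 := by
  rcases le_total x 0 with h | h
  · exact Or.inl (EReal.toENNReal_of_nonpos h)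
  · exact Or.inr (EReal.toENNReal_of_nonpos (by simpa using h))

/-- Writing `a` and `b` as positive minus negative part and moving the negative parts across gives a
form of the inequality free of subtraction. -/
lemma ofReal_add_ofReal_neg_le {a b p c x δ : ℝ} (hp : 0 ≤ p) (hc : 0 ≤ c) (hx : 0 ≤ x)
    (hδ : 0 ≤ δ) (h : a + p * c + δ ≤ b + p * x) :
    ENNReal.ofReal a + ENNReal.ofReal (-b) + ENNReal.ofReal p * ENNReal.ofReal c +
        ENNReal.ofReal δ ≤
      ENNReal.ofReal b + ENNReal.ofReal (-a) + ENNReal.ofReal p * ENNReal.ofReal x := by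
  have hmax (y : ℝ) : ENNReal.ofReal y = ENNReal.ofReal (max y 0) := by
    rcases le_total y 0 with hy | hy
    · rw [max_eq_right hy, ENNReal.ofReal_zero, ENNReal.ofReal_of_nonpos hy]
    · rw [max_eq_left hy]
  have hdiff (y : ℝ) : max y 0 - max (-y) 0 = y := by
    rcases le_total y 0 with hy | hy
    · rw [max_eq_right hy, max_eq_left (by linarith)]; ring
    · rw [max_eq_left hy, max_eq_right (by linarith)]; ring
  have h0 (y : ℝ) : 0 ≤ max y 0 := le_max_right _ _
  rw [hmax a, hmax (-a), hmax b, hmax (-b), ← ENNReal.ofReal_mul hp, ← ENNReal.ofReal_mul hp,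
    ← ENNReal.ofReal_add (h0 _) (h0 _), ← ENNReal.ofReal_add (h0 _) (h0 _),
    ← ENNReal.ofReal_add (add_nonneg (h0 _) (h0 _)) (mul_nonneg hp hc),
    ← ENNReal.ofReal_add (add_nonneg (h0 _) (h0 _)) (mul_nonneg hp hx),
    ← ENNReal.ofReal_add (add_nonneg (add_nonneg (h0 _) (h0 _)) (mul_nonneg hp hc)) hδ]
  refine ENNReal.ofReal_le_ofReal ?_
  linarith [hdiff a, hdiff b]

namespace Primitives

variable {Z E₁ E₂ E₃ : Type*} [Fintype Z] [MeasurableSpace Z]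
    [MeasurableSingletonClass Z] [MeasurableSpace E₁] [MeasurableSpace E₂]
    [MeasurableSpace E₃] (M : Primitives Z E₁ E₂ E₃)

lemma strictAntiOn_du : StrictAntiOn M.du (Set.Ioi 0) := by
  refine strictAntiOn_of_deriv_neg (convex_Ioi 0) M.u_diff2.continuousOn fun x hx => ?_
  rw [interior_Ioi] at hx
  exact M.u_deriv2_neg x hx

lemma du_pos {c : ℝ} (hc : 0 < c) : 0 < M.du c := M.u_deriv_pos c hc

lemma marginal_zero : M.marginal 0 = ⊤ := if_pos rfl

lemma marginal_of_pos {c : ℝ≥0} (hc : 0 < c) : M.marginal c = ENNReal.ofReal (M.du c) :=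
  if_neg hc.ne'

lemma marginal_ne_top {c : ℝ≥0} (hc : 0 < c) : M.marginal c ≠ ⊤ := by
  rw [M.marginal_of_pos hc]
  exact ENNReal.ofReal_ne_top

lemma strictAnti_marginal : StrictAnti M.marginal := by
  intro a b hab
  have hb : 0 < b := pos_of_gt hab
  rcases eq_zero_or_pos a with rfl | ha
  · rw [marginal_zero]
    exact (M.marginal_ne_top hb).lt_top
  · rw [M.marginal_of_pos ha, M.marginal_of_pos hb,
      ENNReal.ofReal_lt_ofReal_iff (M.du_pos (NNReal.coe_pos.2 ha))]
    exact M.strictAntiOn_du (NNReal.coe_pos.2 ha) (NNReal.coe_pos.2 hb) (NNReal.coe_lt_coe.2 hab)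

/-- At `0` this is the Inada condition. Continuity into `ℝ≥0∞`, with value `⊤` at `0`, lets the
Euler equation be solved and passed to limits without treating zero consumption apart. -/
lemma continuous_marginal : Continuous M.marginal := by
  rw [continuous_iff_continuousAt]
  intro a
  rcases eq_zero_or_pos a with rfl | ha
  · rw [ContinuousAt, marginal_zero, ENNReal.tendsto_nhds_top_iff_nnreal]
    intro x
    have h1 := M.u_deriv_zero.eventually_gt_atTop (x : ℝ)
    rw [eventually_nhdsWithin_iff, Metric.eventually_nhds_iff] at h1
    obtain ⟨δ, hδ, h⟩ := h1
    rw [Metric.eventually_nhds_iff]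
    refine ⟨δ, hδ, fun y hy => ?_⟩
    rcases eq_zero_or_pos y with rfl | hy0
    · simp [marginal_zero]
    · rw [M.marginal_of_pos hy0, ← ENNReal.ofReal_coe_nnreal]
      refine (ENNReal.ofReal_lt_ofReal_iff (M.du_pos (NNReal.coe_pos.2 hy0))).2 ?_
      exact h (by simpa [NNReal.dist_eq] using hy) (NNReal.coe_pos.2 hy0)
  · have h1 : ContinuousAt (fun x : ℝ≥0 => ENNReal.ofReal (M.du x)) a := by
      refine ENNReal.continuous_ofReal.continuousAt.comp ?_
      refine ContinuousAt.comp (g := M.du) (f := fun x : ℝ≥0 => (x : ℝ)) ?_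
        NNReal.continuous_coe.continuousAt
      exact M.u_diff2.continuousOn.continuousAt (Ioi_mem_nhds (NNReal.coe_pos.2 ha))
    refine h1.congr ?_
    filter_upwards [lt_mem_nhds ha] with x hx
    exact (M.marginal_of_pos hx).symm

lemma hasDerivAt_u {c : ℝ} (hc : 0 < c) :
    HasDerivAt (fun x => (M.u x).toReal) (M.du c) c :=
  (M.u_diff.differentiableAt (Ioi_mem_nhds hc)).hasDerivAt

/-- By the mean value theorem the chord slope is `u'` at an intermediate point, and `u'` is strictly
decreasing. -/
lemma u_lt_tangent {c x : ℝ} (hc : 0 < c) (hx : 0 < x) (hcx : c ≠ x) :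
    (M.u x).toReal + M.du c * c < (M.u c).toReal + M.du c * x := by
  have hcont : ContinuousOn (fun x => (M.u x).toReal) (Set.Ioi 0) := M.u_diff.continuousOn
  rcases lt_or_gt_of_ne hcx with h | h
  · obtain ⟨ξ, hξ, h1⟩ := exists_hasDerivAt_eq_slope (fun x => (M.u x).toReal) M.du h
      (hcont.mono fun y hy => hc.trans_le hy.1) fun y hy => M.hasDerivAt_u (hc.trans hy.1)
    have h2 := M.strictAntiOn_du hc (hc.trans hξ.1) hξ.1
    rw [h1, div_lt_iff₀ (by linarith)] at h2
    linarith
  · obtain ⟨ξ, hξ, h1⟩ := exists_hasDerivAt_eq_slope (fun x => (M.u x).toReal) M.du h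
      (hcont.mono fun y hy => hx.trans_le hy.1) fun y hy => M.hasDerivAt_u (hx.trans hy.1)
    have h2 := M.strictAntiOn_du (hx.trans hξ.1) hc hξ.2
    rw [h1, lt_div_iff₀ (by linarith)] at h2
    linarith

lemma u_le_tangent {c x : ℝ} (hc : 0 < c) (hx : 0 < x) :
    (M.u x).toReal + M.du c * c ≤ (M.u c).toReal + M.du c * x := by
  rcases eq_or_ne c x with rfl | h
  · exact le_rfl
  · exact (M.u_lt_tangent hc hx h).le

lemma coe_toReal_u {c : ℝ} (hc : 0 < c) : ((M.u c).toReal : EReal) = M.u c :=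
  EReal.coe_toReal (M.u_ne_top c hc.le) (M.u_ne_bot c hc)

/-- The positive part of utility. -/
def upos (c : ℝ≥0) : ℝ≥0∞ := (M.u c).toENNReal

/-- The negative part of utility. -/
def uneg (c : ℝ≥0) : ℝ≥0∞ := (-M.u c).toENNReal

lemma upos_of_pos {c : ℝ≥0} (hc : 0 < c) : M.upos c = ENNReal.ofReal (M.u c).toReal := by
  rw [upos, ← M.coe_toReal_u (NNReal.coe_pos.2 hc), EReal.toReal_coe, EReal.toENNReal_of_ne_top]
  · simp
  · simp

lemma uneg_of_pos {c : ℝ≥0} (hc : 0 < c) : M.uneg c = ENNReal.ofReal (-(M.u c).toReal) := by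
  rw [uneg, ← M.coe_toReal_u (NNReal.coe_pos.2 hc), EReal.toReal_coe, ← EReal.coe_neg,
    EReal.toENNReal_of_ne_top]
  · simp
  · simp

lemma upos_ne_top (c : ℝ≥0) : M.upos c ≠ ⊤ := by
  rw [upos, Ne, EReal.toENNReal_eq_top_iff]
  exact M.u_ne_top c c.2

lemma uneg_ne_top {c : ℝ≥0} (hc : 0 < c) : M.uneg c ≠ ⊤ := by
  rw [M.uneg_of_pos hc]
  exact ENNReal.ofReal_ne_top

lemma tangent_strict {c x : ℝ≥0} (hc : 0 < c) (hx : 0 < x) (hcx : c ≠ x) :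
    ∃ δ > 0, M.upos x + M.uneg c + M.marginal c * c + δ ≤
      M.upos c + M.uneg x + M.marginal c * x := by
  have h := M.u_lt_tangent (NNReal.coe_pos.2 hc) (NNReal.coe_pos.2 hx)
    (fun h => hcx (NNReal.coe_injective h))
  refine ⟨ENNReal.ofReal ((M.u c).toReal + M.du c * x - ((M.u x).toReal + M.du c * c)),
    ENNReal.ofReal_pos.2 (sub_pos.2 h), ?_⟩
  rw [M.upos_of_pos hc, M.upos_of_pos hx, M.uneg_of_pos hc, M.uneg_of_pos hx,
    M.marginal_of_pos hc, ← ENNReal.ofReal_coe_nnreal, ← ENNReal.ofReal_coe_nnreal]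
  exact ofReal_add_ofReal_neg_le (M.du_pos (NNReal.coe_pos.2 hc)).le c.2 x.2 (by linarith)
    (by linarith)

/-- The tangent line inequality for the concave utility, in terms of positive and negative
parts. -/
lemma tangent_le (c x : ℝ≥0) :
    M.upos x + M.uneg c + M.marginal c * c ≤ M.upos c + M.uneg x + M.marginal c * x := by
  rcases eq_zero_or_pos c with rfl | hc
  · rcases eq_zero_or_pos x with rfl | hx
    · simp
    · have h : (⊤ : ℝ≥0∞) * x = ⊤ := ENNReal.top_mul (by simpa using hx.ne')
      simp [marginal_zero, h]
  have hdu := M.du_pos (NNReal.coe_pos.2 hc)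
  rcases eq_zero_or_pos x with rfl | hx
  · by_cases hbot : M.u 0 = ⊥
    · simp [uneg, hbot]
    · have h0 : ((M.u 0).toReal : EReal) = M.u 0 :=
        EReal.coe_toReal (M.u_ne_top 0 le_rfl) hbot
      have hle : (M.u 0).toReal + M.du c * c ≤ (M.u c).toReal + M.du c * 0 := by
        refine le_of_forall_pos_le_add fun ε hε => ?_
        -- Continuity of `u` at `0` is not assumed. The bound `u 0 ≤ u y` is used at a small `y`
        -- whose tangent contribution `u'(c) y` is exactly `ε`.
        have hy : 0 < ε / M.du c := div_pos hε hdu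
        have h1 := M.u_le_tangent (NNReal.coe_pos.2 hc) hy
        have h2 := M.u_zero_le _ hy
        rw [← h0, ← M.coe_toReal_u hy, EReal.coe_le_coe_iff] at h2
        have h3 : M.du c * (ε / M.du c) = ε := by field_simp
        linarith
      have hp : M.upos 0 = ENNReal.ofReal (M.u 0).toReal := by
        rw [upos, NNReal.coe_zero, ← h0, EReal.toReal_coe, EReal.toENNReal_of_ne_top (by simp)]
        simp
      have hn : M.uneg 0 = ENNReal.ofReal (-(M.u 0).toReal) := by
        rw [uneg, NNReal.coe_zero, ← h0, EReal.toReal_coe, ← EReal.coe_neg,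
          EReal.toENNReal_of_ne_top (by simp)]
        simp
      rw [M.upos_of_pos hc, hp, M.uneg_of_pos hc, hn,
        M.marginal_of_pos hc, ← ENNReal.ofReal_coe_nnreal, ← ENNReal.ofReal_coe_nnreal]
      simpa using ofReal_add_ofReal_neg_le hdu.le c.2 le_rfl le_rfl (by simpa using hle)
  · rcases eq_or_ne c x with rfl | hcx
    · exact le_rfl
    · obtain ⟨δ, -, h⟩ := M.tangent_strict hc hx hcx
      exact le_self_add.trans h

/-- The tangent at `1` bounds utility linearly, so summable discounted wealth controls the positive
part of lifetime value. -/
lemma upos_le (x : ℝ≥0) : M.upos x ≤ M.upos 1 + M.marginal 1 * x := by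
  rcases EReal_toENNReal_eq_zero_or (M.u x) with h | h
  · simp [upos, h]
  · have h1 := M.tangent_le 1 x
    rw [show M.uneg x = 0 from h, add_zero, add_assoc] at h1
    exact le_self_add.trans h1

/-- The tangent at `x`, evaluated at `1`. It turns the moment condition on `u'(Y)` into a bound on
disutility. -/
lemma uneg_le (x : ℝ≥0) : M.uneg x ≤ M.uneg 1 + M.marginal x := by
  rcases EReal_toENNReal_eq_zero_or (M.u x) with h | h
  · have h1 := M.tangent_le x 1
    rw [show M.upos x = 0 from h, zero_add, ENNReal.coe_one, mul_one] at h1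
    exact (le_add_self.trans le_self_add).trans h1
  · simp [uneg, h]

lemma monotone_u : Monotone fun x : ℝ≥0 => M.u x := by
  intro x y hxy
  rcases eq_zero_or_pos y with rfl | hy
  · simp [le_zero_iff.1 hxy]
  rcases eq_zero_or_pos x with rfl | hx
  · exact M.u_zero_le y (NNReal.coe_pos.2 hy)
  · simp only
    rw [← M.coe_toReal_u (NNReal.coe_pos.2 hx), ← M.coe_toReal_u (NNReal.coe_pos.2 hy),
      EReal.coe_le_coe_iff]
    have h := M.u_le_tangent (NNReal.coe_pos.2 hy) (NNReal.coe_pos.2 hx)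
    have h2 := mul_le_mul_of_nonneg_left (NNReal.coe_le_coe.2 hxy)
      (M.du_pos (NNReal.coe_pos.2 hy)).le
    linarith

lemma measurable_upos : Measurable M.upos :=
  measurable_ereal_toENNReal.comp M.monotone_u.measurable

lemma measurable_uneg : Measurable M.uneg :=
  (measurable_ereal_toENNReal.comp continuous_neg.measurable).comp M.monotone_u.measurable

end Primitives

/-! ### The Euler equation and time iteration -/

namespace Primitives

variable {Z E₁ E₂ E₃ : Type*} [Fintype Z] [MeasurableSpace Z]
    [MeasurableSingletonClass Z] [MeasurableSpace E₁] [MeasurableSpace E₂]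
    [MeasurableSpace E₃] (M : Primitives Z E₁ E₂ E₃)

/-- The mean of the discount factor in state `z`. -/
def meanβ (z : Z) : ℝ≥0∞ := ∫⁻ x, M.β z x ∂M.πε

/-- The mean gross return in state `z`. -/
def meanR (z : Z) : ℝ≥0∞ := ∫⁻ x, M.R z x ∂M.πζ

/-- The mean income in state `z`. -/
def meanY (z : Z) : ℝ≥0∞ := ∫⁻ x, M.Y z x ∂M.πη

/-- The mean marginal utility of income in state `z`. -/
def meanMargY (z : Z) : ℝ≥0∞ := ∫⁻ x, M.marginal (M.Y z x) ∂M.πη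

/-- The finiteness properties of the primitives that follow from the growth conditions. -/
structure Regular : Prop where
  meanβ_ne_top : ∀ z, M.meanβ z ≠ ⊤
  meanR_ne_top : ∀ z, M.meanR z ≠ ⊤
  meanY_ne_top : ∀ z, M.meanY z ≠ ⊤
  meanMargY_ne_top : ∀ z, M.meanMargY z ≠ ⊤
  resolvent_β : ∀ z, M.resolvent M.meanβ 1 z ≠ ⊤
  resolvent_βR : ∀ z, M.resolvent (fun z => M.meanβ z * M.meanR z) 1 z ≠ ⊤

lemma measurable_marginal : Measurable M.marginal := M.continuous_marginal.measurable

lemma measurable_marginal_Y (z : Z) : Measurable fun x => M.marginal (M.Y z x) :=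
  M.measurable_marginal.comp (M.measurable_Y z)

lemma lintegral_β_R_mul (z : Z) {h : E₃ → ℝ≥0∞} (hh : Measurable h) :
    ∫⁻ e, (M.β z e.1 : ℝ≥0∞) * M.R z e.2.1 * h e.2.2 ∂M.innovLaw =
      M.meanβ z * M.meanR z * ∫⁻ x, h x ∂M.πη :=
  M.lintegral_innovLaw_mul (M.measurable_β z).coe_nnreal_ennreal
    (M.measurable_R z).coe_nnreal_ennreal hh

lemma lintegral_β_R (z : Z) :
    ∫⁻ e, (M.β z e.1 : ℝ≥0∞) * M.R z e.2.1 ∂M.innovLaw = M.meanβ z * M.meanR z := by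
  simpa using M.lintegral_β_R_mul z (h := fun _ => 1) measurable_const

lemma lintegral_β_mul (z : Z) {h : E₃ → ℝ≥0∞} (hh : Measurable h) :
    ∫⁻ e, (M.β z e.1 : ℝ≥0∞) * h e.2.2 ∂M.innovLaw = M.meanβ z * ∫⁻ x, h x ∂M.πη := by
  simpa [meanβ] using M.lintegral_innovLaw_mul (M.measurable_β z).coe_nnreal_ennreal
    (g := fun _ => 1) measurable_const hh

lemma lintegral_β (z : Z) : ∫⁻ e, (M.β z e.1 : ℝ≥0∞) ∂M.innovLaw = M.meanβ z := by
  simpa using M.lintegral_β_mul z (h := fun _ => 1) measurable_const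

lemma lintegral_R (z : Z) : ∫⁻ e, (M.R z e.2.1 : ℝ≥0∞) ∂M.innovLaw = M.meanR z := by
  simpa [meanR] using M.lintegral_innovLaw_mul (f := fun _ => 1) (h := fun _ => 1) measurable_const
    (M.measurable_R z).coe_nnreal_ennreal measurable_const

lemma lintegral_Y {h : E₃ → ℝ≥0∞} (hh : Measurable h) :
    ∫⁻ e, h e.2.2 ∂M.innovLaw = ∫⁻ x, h x ∂M.πη := by
  simpa using M.lintegral_innovLaw_mul (f := fun _ => 1) (g := fun _ => 1) measurable_const
    measurable_const hh

lemma step_mono {F G : Z → E₁ × E₂ × E₃ → ℝ≥0∞} (h : ∀ z e, F z e ≤ G z e) (z : Z) :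
    M.step F z ≤ M.step G z := by
  unfold step
  gcongr with z' _ e
  exact h z' e

/-- Expected discounted return times next period's marginal utility of consumption, when `k` is
saved today and the policy `c` is followed tomorrow. -/
def marginalSaving (c : ℝ≥0 → Z → ℝ≥0) (k : ℝ≥0) (z : Z) : ℝ≥0∞ :=
  M.step (fun z' e => (M.β z' e.1 : ℝ≥0∞) * M.R z' e.2.1 *
    M.marginal (c (M.R z' e.2.1 * k + M.Y z' e.2.2) z')) z

/-- A bound for `u' (c (a, z)) - u' a` that the policy iteration preserves. -/
def gapBound (z : Z) : ℝ≥0∞ :=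
  M.resolvent (fun z => M.meanβ z * M.meanR z)
    (M.transfer (fun z => M.meanβ z * M.meanR z) M.meanMargY) z

variable {M} in
lemma Regular.gapBound_ne_top (hM : M.Regular) (z : Z) : M.gapBound z ≠ ⊤ :=
  M.resolvent_ne_top hM.resolvent_βR (M.transfer_ne_top
    (fun z => ENNReal.mul_ne_top (hM.meanβ_ne_top z) (hM.meanR_ne_top z))
    hM.meanMargY_ne_top) z

/-- Policies with the properties that the policy iteration preserves. -/
structure IsRegularPolicy (s : ℝ≥0) (c : ℝ≥0 → Z → ℝ≥0) : Prop where
  mono : ∀ z, Monotone fun a => c a z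
  savings_mono : ∀ z, Monotone fun a => a - c a z
  le : ∀ a z, c a z ≤ a
  lower : ∀ a z, (1 - s) * a ≤ c a z
  marginal_le : ∀ a z, M.marginal (c a z) ≤ M.marginal a + M.gapBound z

/-- `ξ` solves the Euler equation at `(a, z)` when `c` is followed from tomorrow on. -/
structure IsEulerSol (c : ℝ≥0 → Z → ℝ≥0) (a : ℝ≥0) (z : Z) (ξ : ℝ≥0) : Prop where
  le : ξ ≤ a
  eq : M.marginal ξ = max (M.marginalSaving c (a - ξ) z) (M.marginal a)

/-- The linear savings bound in terms of the primitives. -/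
def SavingsBound (s : ℝ≥0) : Prop :=
  s < 1 ∧ ∀ (a : ℝ≥0) (z : Z), 0 < a →
    M.step (fun z' e => (M.β z' e.1 : ℝ≥0∞) * M.R z' e.2.1 *
      M.marginal (M.R z' e.2.1 * s * a)) z ≤ M.marginal a

lemma marginalSaving_anti {c d : ℝ≥0 → Z → ℝ≥0} (hd : ∀ z, Monotone fun a => d a z)
    (hcd : ∀ a z, c a z ≤ d a z) {k l : ℝ≥0} (hkl : k ≤ l) (z : Z) :
    M.marginalSaving d l z ≤ M.marginalSaving c k z := by
  refine M.step_mono (fun z' e => ?_) z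
  gcongr
  exact M.strictAnti_marginal.antitone
    ((hcd _ _).trans (hd z' (by gcongr)))

namespace IsRegularPolicy

variable {M} {s : ℝ≥0} {c : ℝ≥0 → Z → ℝ≥0}

/-- Consumption and savings both increase and add up to wealth, so neither can grow faster than
wealth. -/
lemma lipschitz (hc : M.IsRegularPolicy s c) (z : Z) : LipschitzWith 1 fun a => c a z := by
  refine LipschitzWith.of_le_add fun a b => ?_
  rw [NNReal.dist_eq]
  rcases le_total a b with h | h
  · have h1 : (c a z : ℝ) ≤ c b z := NNReal.coe_le_coe.2 (hc.mono z h)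
    have h2 := abs_nonneg ((a : ℝ) - b)
    have h3 : (c a z : ℝ) ≤ c b z + |(a : ℝ) - b| := by linarith
    exact h3
  · have h1 := hc.savings_mono z h
    simp only at h1
    have h2 : (b : ℝ) - c b z ≤ a - c a z := by
      rw [← NNReal.coe_sub (hc.le b z), ← NNReal.coe_sub (hc.le a z)]
      exact NNReal.coe_le_coe.2 h1
    have h3 := le_abs_self ((a : ℝ) - b)
    have h4 : (c a z : ℝ) ≤ c b z + |(a : ℝ) - b| := by linarith
    exact h4

lemma continuous (hc : M.IsRegularPolicy s c) (z : Z) : Continuous fun a => c a z :=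
  (hc.lipschitz z).continuous

lemma marginal_next_le (hc : M.IsRegularPolicy s c) (k r y : ℝ≥0) (z : Z) :
    M.marginal (c (r * k + y) z) ≤ M.marginal y + M.gapBound z := by
  refine (hc.marginal_le _ z).trans ?_
  gcongr
  exact M.strictAnti_marginal.antitone le_add_self

lemma lintegral_bound (M : Primitives Z E₁ E₂ E₃) (z : Z) :
    ∫⁻ e, (M.β z e.1 : ℝ≥0∞) * M.R z e.2.1 * (M.marginal (M.Y z e.2.2) + M.gapBound z)
      ∂M.innovLaw = M.meanβ z * M.meanR z * (M.meanMargY z + M.gapBound z) := by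
  rw [M.lintegral_β_R_mul z ((M.measurable_marginal_Y z).add_const _),
    lintegral_add_right _ measurable_const, lintegral_const, measure_univ, mul_one, meanMargY]

/-- Tomorrow's wealth is at least income, so tomorrow's marginal utility is at most `u'(Y)` plus the
gap. `gapBound` is built to solve `K = T (meanMargY + K)` for the operator `T` with weight `meanβ *
meanR`, and the estimate reproduces itself. -/
lemma marginalSaving_le (hc : M.IsRegularPolicy s c) (k : ℝ≥0) (z : Z) :
    M.marginalSaving c k z ≤ M.gapBound z := by
  have h1 : M.marginalSaving c k z ≤ M.step (fun z' e => (M.β z' e.1 : ℝ≥0∞) * M.R z' e.2.1 *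
      (M.marginal (M.Y z' e.2.2) + M.gapBound z')) z := by
    refine M.step_mono (fun z' e => ?_) z
    gcongr
    exact hc.marginal_next_le _ _ _ _
  refine h1.trans_eq ?_
  rw [gapBound, resolvent_eq]
  change _ = _ + M.transfer _ M.gapBound z
  simp only [step, lintegral_bound]
  simp only [transfer, ← Finset.sum_add_distrib, mul_add]

/-- Dominated convergence with bound `β R (u'(Y) + gapBound)`. The common Lipschitz constant allows
the policy and its argument to vary together. -/
lemma tendsto_marginalSaving (hM : M.Regular) {cs : ℕ → ℝ≥0 → Z → ℝ≥0}
    (hcs : ∀ n, M.IsRegularPolicy s (cs n))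
    (hlim : ∀ a z, Tendsto (fun n => cs n a z) atTop (𝓝 (c a z))) {ks : ℕ → ℝ≥0} {k : ℝ≥0}
    (hks : Tendsto ks atTop (𝓝 k)) (z : Z) :
    Tendsto (fun n => M.marginalSaving (cs n) (ks n) z) atTop
      (𝓝 (M.marginalSaving c k z)) := by
  refine tendsto_finsetSum _ fun z' _ => ?_
  refine ENNReal.Tendsto.const_mul ?_ (Or.inr (M.P_ne_top z z'))
  refine tendsto_lintegral_of_dominated_convergence
    (fun e => (M.β z' e.1 : ℝ≥0∞) * M.R z' e.2.1 * (M.marginal (M.Y z' e.2.2) + M.gapBound z'))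
    (fun n => ?_) (fun n => ?_) ?_ ?_
  · have h1 := M.measurable_β z'
    have h2 := M.measurable_R z'
    have h3 := M.measurable_Y z'
    have h4 := M.measurable_marginal.comp ((hcs n).continuous z').measurable
    have h5 : Measurable fun e : E₁ × E₂ × E₃ => M.R z' e.2.1 * ks n + M.Y z' e.2.2 := by fun_prop
    exact Measurable.mul (by fun_prop) (h4.comp h5)
  · refine Eventually.of_forall fun e => ?_
    beta_reduce
    gcongr
    exact (hcs n).marginal_next_le _ _ _ _
  · rw [lintegral_bound]
    exact ENNReal.mul_ne_top (ENNReal.mul_ne_top (hM.meanβ_ne_top z') (hM.meanR_ne_top z'))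
      (ENNReal.add_ne_top.2 ⟨hM.meanMargY_ne_top z', hM.gapBound_ne_top z'⟩)
  · refine Eventually.of_forall fun e => ?_
    refine ENNReal.Tendsto.const_mul ?_
      (Or.inr (ENNReal.mul_ne_top ENNReal.coe_ne_top ENNReal.coe_ne_top))
    refine (M.continuous_marginal.tendsto _).comp ?_
    have hx : Tendsto (fun n => M.R z' e.2.1 * ks n + M.Y z' e.2.2) atTop
        (𝓝 (M.R z' e.2.1 * k + M.Y z' e.2.2)) := (hks.const_mul _).add_const _
    rw [tendsto_iff_dist_tendsto_zero] at hx ⊢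
    have h0 := hlim (M.R z' e.2.1 * k + M.Y z' e.2.2) z'
    rw [tendsto_iff_dist_tendsto_zero] at h0
    refine squeeze_zero (fun _ => dist_nonneg) (fun n => ?_)
      (by simpa using hx.add h0)
    refine (dist_triangle _ (cs n (M.R z' e.2.1 * k + M.Y z' e.2.2) z') _).trans ?_
    gcongr
    simpa using ((hcs n).lipschitz z').dist_le_mul
      (M.R z' e.2.1 * ks n + M.Y z' e.2.2) (M.R z' e.2.1 * k + M.Y z' e.2.2)

lemma continuous_marginalSaving (hM : M.Regular) (hc : M.IsRegularPolicy s c) (z : Z) :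
    Continuous fun k => M.marginalSaving c k z :=
  continuous_iff_seqContinuous.2 fun _ _ hks =>
    tendsto_marginalSaving hM (fun _ => hc) (fun _ _ => tendsto_const_nhds) hks z

/-- Intermediate value theorem on `[0, a]`: the left side is `⊤` at `ξ = 0`, while at `ξ = a` it
equals one of the two terms of the maximum. -/
lemma exists_isEulerSol (hM : M.Regular) (hc : M.IsRegularPolicy s c) (a : ℝ≥0) (z : Z) :
    ∃ ξ, M.IsEulerSol c a z ξ := by
  have h1 : Continuous fun ξ : ℝ≥0 => max (M.marginalSaving c (a - ξ) z) (M.marginal a) :=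
    ((hc.continuous_marginalSaving hM z).comp (by fun_prop : Continuous fun ξ : ℝ≥0 => a - ξ)).max
      continuous_const
  obtain ⟨ξ, hξ, h⟩ := isPreconnected_Icc.intermediate_value₂ (s := Set.Icc 0 a)
    (a := a) (b := 0) ⟨zero_le, le_rfl⟩ ⟨le_rfl, zero_le⟩ M.continuous_marginal.continuousOn
    h1.continuousOn (le_max_right _ _) (by simp [marginal_zero])
  exact ⟨ξ, hξ.2, h⟩

end IsRegularPolicy

namespace IsEulerSol

variable {M} {s : ℝ≥0} {c d : ℝ≥0 → Z → ℝ≥0} {a b ξ ξ' : ℝ≥0} {z : Z}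

/-- If `ξ' < ξ`, then at `b` savings are at least as large and future consumption is no smaller, so
the right side of the Euler equation is no larger there, against `u'(ξ) < u'(ξ')`. This serves both
monotonicity in wealth and the decrease of the iterates. -/
lemma le_of_le (hd : ∀ z, Monotone fun a => d a z) (hcd : ∀ a z, c a z ≤ d a z)
    (hab : a ≤ b) (h : M.IsEulerSol c a z ξ) (h' : M.IsEulerSol d b z ξ') : ξ ≤ ξ' := by
  by_contra! hlt
  have h1 := M.strictAnti_marginal hlt
  rw [h.eq, h'.eq] at h1
  refine h1.not_ge (max_le_max ?_ (M.strictAnti_marginal.antitone hab))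
  exact M.marginalSaving_anti hd hcd (tsub_le_tsub hab hlt.le) z

/-- Strictly larger savings at the lower wealth force `ξ < a` and `ξ < ξ'`. Then `u'(ξ)` strictly
exceeds both terms of its own maximum. -/
lemma savings_le (hc : ∀ z, Monotone fun a => c a z)
    (hab : a ≤ b) (h : M.IsEulerSol c a z ξ) (h' : M.IsEulerSol c b z ξ') :
    a - ξ ≤ b - ξ' := by
  by_contra! hlt
  have hξa : ξ < a := tsub_pos_iff_lt.1 (pos_of_gt hlt)
  have hξ : ξ < ξ' := by
    by_contra! h2
    exact hlt.not_ge (tsub_le_tsub hab h2)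
  have h1 := M.strictAnti_marginal hξ
  have h2 := M.strictAnti_marginal hξa
  have h3 : M.marginalSaving c (a - ξ) z ≤ M.marginal ξ' := by
    rw [h'.eq]
    exact (M.marginalSaving_anti hc (fun _ _ => le_rfl) hlt.le z).trans (le_max_left _ _)
  have h4 := h.eq
  exact (max_lt (h3.trans_lt h1) h2).ne' h4

/-- If consumption fell below `(1 - s) a`, savings would be at least `s a`, and tomorrow's
consumption at least `R s ((1 - s) a)`. The savings bound at wealth `(1 - s) a` then caps the
marginal value of saving by `u'((1 - s) a) < u'(ξ)`. -/
lemma lower (hs : M.SavingsBound s) (hc : M.IsRegularPolicy s c) (h : M.IsEulerSol c a z ξ) :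
    (1 - s) * a ≤ ξ := by
  by_contra! hlt
  have ha : 0 < (1 - s) * a := pos_of_gt hlt
  have h1 := M.strictAnti_marginal hlt
  have hle : (1 - s) * a ≤ a := by
    calc (1 - s) * a ≤ 1 * a := by gcongr; exact tsub_le_self
      _ = a := one_mul a
  have hk : s * a ≤ a - ξ := by
    refine le_tsub_of_add_le_right ?_
    calc s * a + ξ ≤ s * a + (1 - s) * a := by gcongr
      _ = a := by rw [← add_mul, add_tsub_cancel_of_le hs.1.le, one_mul]
  have h2 : M.marginalSaving c (a - ξ) z ≤ M.marginal ((1 - s) * a) := by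
    refine le_trans (M.step_mono (fun z' e => ?_) z) (hs.2 _ z ha)
    gcongr
    refine M.strictAnti_marginal.antitone ?_
    calc M.R z' e.2.1 * s * ((1 - s) * a) = (1 - s) * (M.R z' e.2.1 * (s * a)) := by ring
      _ ≤ (1 - s) * (M.R z' e.2.1 * (a - ξ) + M.Y z' e.2.2) := by
        gcongr
        exact le_add_of_le_left (by gcongr)
      _ ≤ _ := hc.lower _ _
  have h3 := (max_le h2 (M.strictAnti_marginal.antitone hle)).trans_lt h1
  exact h3.ne' h.eq

end IsEulerSol

lemma isRegularPolicy_of_isEulerSol {s : ℝ≥0} {c d : ℝ≥0 → Z → ℝ≥0}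
    (hs : M.SavingsBound s) (hc : M.IsRegularPolicy s c)
    (hd : ∀ a z, M.IsEulerSol c a z (d a z)) : M.IsRegularPolicy s d where
  mono z a b hab := (hd a z).le_of_le hc.mono (fun _ _ => le_rfl) hab (hd b z)
  savings_mono z a b hab := (hd a z).savings_le hc.mono hab (hd b z)
  le a z := (hd a z).le
  lower a z := (hd a z).lower hs hc
  marginal_le a z := by
    rw [(hd a z).eq]
    exact max_le ((hc.marginalSaving_le _ z).trans le_add_self) le_self_add

lemma isRegularPolicy_id (s : ℝ≥0) : M.IsRegularPolicy s fun a _ => a where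
  mono _ := monotone_id
  savings_mono _ a b _ := by simp
  le _ _ := le_rfl
  lower a _ := by
    calc (1 - s) * a ≤ 1 * a := by gcongr; exact tsub_le_self
      _ = a := one_mul a
  marginal_le _ _ := le_self_add

/-- Every defining property is a weak inequality between continuous expressions. Strict positivity
of consumption is not listed because it follows from the bound on marginal utility. -/
lemma isRegularPolicy_of_tendsto {s : ℝ≥0} {cs : ℕ → ℝ≥0 → Z → ℝ≥0} {c : ℝ≥0 → Z → ℝ≥0}
    (hcs : ∀ n, M.IsRegularPolicy s (cs n))
    (hlim : ∀ a z, Tendsto (fun n => cs n a z) atTop (𝓝 (c a z))) : M.IsRegularPolicy s c where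
  mono z a b hab := le_of_tendsto_of_tendsto' (hlim a z) (hlim b z) fun n => (hcs n).mono z hab
  savings_mono z a b hab := le_of_tendsto_of_tendsto' (tendsto_const_nhds.sub (hlim a z))
    (tendsto_const_nhds.sub (hlim b z)) fun n => (hcs n).savings_mono z hab
  le a z := le_of_tendsto' (hlim a z) fun n => (hcs n).le a z
  lower a z := ge_of_tendsto' (hlim a z) fun n => (hcs n).lower a z
  marginal_le a z := le_of_tendsto' ((M.continuous_marginal.tendsto _).comp (hlim a z))
    fun n => (hcs n).marginal_le a z

/-- Existence of a policy that satisfies the Euler equation, by monotone iteration of the time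
iteration operator from the policy that consumes everything. -/
theorem exists_isEulerSol_self {s : ℝ≥0} (hM : M.Regular) (hs : M.SavingsBound s) :
    ∃ c, M.IsRegularPolicy s c ∧ ∀ a z, M.IsEulerSol c a z (c a z) := by
  let next : {c // M.IsRegularPolicy s c} → {c // M.IsRegularPolicy s c} := fun c =>
    ⟨fun a z => (c.2.exists_isEulerSol hM a z).choose, M.isRegularPolicy_of_isEulerSol hs c.2
      fun a z => (c.2.exists_isEulerSol hM a z).choose_spec⟩
  let cs : ℕ → {c // M.IsRegularPolicy s c} := fun n => next^[n] ⟨_, M.isRegularPolicy_id s⟩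
  have hsol n a z : M.IsEulerSol (cs n).1 a z ((cs (n + 1)).1 a z) := by
    have h : cs (n + 1) = next (cs n) := Function.iterate_succ_apply' _ _ _
    rw [h]
    exact ((cs n).2.exists_isEulerSol hM a z).choose_spec
  have hle n : ∀ a z, (cs (n + 1)).1 a z ≤ (cs n).1 a z := by
    induction n with
    | zero => exact fun a z => (hsol 0 a z).le
    | succ n ih =>
      exact fun a z => (hsol (n + 1) a z).le_of_le (cs n).2.mono ih le_rfl (hsol n a z)
  have hlim a z : Tendsto (fun n => (cs n).1 a z) atTop (𝓝 (⨅ n, (cs n).1 a z)) :=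
    tendsto_atTop_ciInf (antitone_nat_of_succ_le fun n => hle n a z) (OrderBot.bddBelow _)
  have hreg := M.isRegularPolicy_of_tendsto (fun n => (cs n).2) hlim
  refine ⟨_, hreg, fun a z => ⟨hreg.le a z, ?_⟩⟩
  have h1 := (hlim a z).comp (tendsto_add_atTop_nat 1)
  -- Both sides of the Euler equation linking iterates `n` and `n + 1` converge, so the equation
  -- holds for the limit.
  refine tendsto_nhds_unique ((M.continuous_marginal.tendsto _).comp h1) ?_
  have h2 := IsRegularPolicy.tendsto_marginalSaving hM (fun n => (cs n).2) hlim
    ((tendsto_const_nhds (x := a)).sub h1) z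
  refine (h2.max (tendsto_const_nhds (x := M.marginal a))).congr fun n => ?_
  exact (hsol n a z).eq.symm

end Primitives

/-! ### Telescoping and summability of present values -/

/-- Telescoping without subtraction, so infinite values are harmless. `w` plays the role of a
Lyapunov function, `x` of what it pays out and `y` of the inflow. -/
lemma add_sum_range_le_of_add_le {w x y : ℕ → ℝ≥0∞} (h : ∀ t, w (t + 1) + x t ≤ w t + y t)
    (n : ℕ) : w n + ∑ t ∈ Finset.range n, x t ≤ w 0 + ∑ t ∈ Finset.range n, y t := by
  induction n with
  | zero => simp
  | succ n ih =>
    rw [Finset.sum_range_succ, Finset.sum_range_succ]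
    calc w (n + 1) + (∑ t ∈ Finset.range n, x t + x n)
        = w (n + 1) + x n + ∑ t ∈ Finset.range n, x t := by ring
      _ ≤ w n + y n + ∑ t ∈ Finset.range n, x t := by gcongr ?_ + _; exact h n
      _ = w n + ∑ t ∈ Finset.range n, x t + y n := by ring
      _ ≤ w 0 + ∑ t ∈ Finset.range n, y t + y n := by gcongr
      _ = _ := by ring

lemma tsum_le_of_add_le {w x y : ℕ → ℝ≥0∞} (h : ∀ t, w (t + 1) + x t ≤ w t + y t) :
    ∑' t, x t ≤ w 0 + ∑' t, y t := by
  rw [ENNReal.tsum_eq_iSup_nat]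
  refine iSup_le fun n => ?_
  calc ∑ t ∈ Finset.range n, x t ≤ w n + ∑ t ∈ Finset.range n, x t := le_add_self
    _ ≤ w 0 + ∑ t ∈ Finset.range n, y t := add_sum_range_le_of_add_le h n
    _ ≤ _ := by gcongr; exact ENNReal.sum_le_tsum _

lemma extend_le {Z : Type*} {c : ℝ≥0 → Z → ℝ≥0} (hc : Feasible c) (a : ℝ≥0) (z : Z) :
    extend c a z ≤ a := by
  unfold extend
  split_ifs with h
  · exact hc.le a z h
  · exact zero_le

namespace Primitives

variable {Z E₁ E₂ E₃ : Type*} [Fintype Z] [MeasurableSpace Z]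
    [MeasurableSingletonClass Z] [MeasurableSpace E₁] [MeasurableSpace E₂]
    [MeasurableSpace E₃] (M : Primitives Z E₁ E₂ E₃)

lemma step_const_mul {F : Z → E₁ × E₂ × E₃ → ℝ≥0∞} (hF : ∀ z, Measurable (F z)) (C : ℝ≥0∞)
    (z : Z) : M.step (fun z' e => C * F z' e) z = C * M.step F z := by
  simp only [step, Finset.mul_sum]
  refine Finset.sum_congr rfl fun z' _ => ?_
  rw [lintegral_const_mul _ (hF z')]
  ring

lemma step_β_R_mul (x : Z → ℝ≥0∞) (z : Z) :
    M.step (fun z' e => (M.β z' e.1 : ℝ≥0∞) * M.R z' e.2.1 * x z') z =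
      M.transfer (fun z => M.meanβ z * M.meanR z) x z := by
  simp only [step, transfer]
  refine Finset.sum_congr rfl fun z' _ => ?_
  rw [M.lintegral_β_R_mul z' (h := fun _ => x z') measurable_const]
  simp

lemma step_β_mul {h : Z → E₃ → ℝ≥0∞} (hh : ∀ z, Measurable (h z)) (z : Z) :
    M.step (fun z' e => (M.β z' e.1 : ℝ≥0∞) * h z' e.2.2) z =
      M.transfer M.meanβ (fun z' => ∫⁻ x, h z' x ∂M.πη) z := by
  simp only [step, transfer]
  exact Finset.sum_congr rfl fun z' _ => by rw [M.lintegral_β_mul z' (hh z')]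

lemma step_β_mul_const (x : Z → ℝ≥0∞) (z : Z) :
    M.step (fun z' e => (M.β z' e.1 : ℝ≥0∞) * x z') z = M.transfer M.meanβ x z := by
  simpa using M.step_β_mul (h := fun z _ => x z) (fun _ => measurable_const) z

end Primitives

namespace Shocks

variable {Z E₁ E₂ E₃ : Type*} [Fintype Z] [MeasurableSpace Z]
    [MeasurableSingletonClass Z] [MeasurableSpace E₁] [MeasurableSpace E₂]
    [MeasurableSpace E₃] {M : Primitives Z E₁ E₂ E₃}
    {Ω : Type*} [MeasurableSpace Ω] {μ : Measure Ω} (S : Shocks M μ)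

lemma discount_zero (ω : Ω) : S.discount 0 ω = 1 := by simp [discount]

lemma discount_succ (t : ℕ) (ω : Ω) :
    S.discount (t + 1) ω = S.discount t ω * S.beta (t + 1) ω :=
  Finset.prod_Icc_succ_top (Nat.le_add_left 1 t) _

/-- Savings `a_t - c_t` at time `t`. -/
def savings (c : ℝ≥0 → Z → ℝ≥0) (a : ℝ≥0) (t : ℕ) (ω : Ω) : ℝ≥0 :=
  S.assets c a t ω - S.consumption c a t ω

lemma assets_zero (c : ℝ≥0 → Z → ℝ≥0) (a : ℝ≥0) (ω : Ω) : S.assets c a 0 ω = a := rfl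

lemma assets_succ (c : ℝ≥0 → Z → ℝ≥0) (a : ℝ≥0) (t : ℕ) (ω : Ω) :
    S.assets c a (t + 1) ω = S.ret (t + 1) ω * S.savings c a t ω + S.income (t + 1) ω := rfl

lemma measurable_beta {t i : ℕ} (h : i ≤ t) : Measurable[S.filt t] (S.beta i) := by
  have h1 : Measurable fun p : Z × (E₁ × E₂ × E₃) => M.β p.1 p.2.1 :=
    measurable_from_prod_countable_right fun z => (M.measurable_β z).comp measurable_fst
  exact h1.comp ((S.measurable_filt_chain h).prodMk (S.measurable_filt_innov h))

lemma measurable_ret {t i : ℕ} (h : i ≤ t) : Measurable[S.filt t] (S.ret i) := by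
  have h1 : Measurable fun p : Z × (E₁ × E₂ × E₃) => M.R p.1 p.2.2.1 :=
    measurable_from_prod_countable_right fun z =>
      (M.measurable_R z).comp (measurable_fst.comp measurable_snd)
  exact h1.comp ((S.measurable_filt_chain h).prodMk (S.measurable_filt_innov h))

lemma measurable_income {t i : ℕ} (h : i ≤ t) : Measurable[S.filt t] (S.income i) := by
  have h1 : Measurable fun p : Z × (E₁ × E₂ × E₃) => M.Y p.1 p.2.2.2 :=
    measurable_from_prod_countable_right fun z =>
      (M.measurable_Y z).comp (measurable_snd.comp measurable_snd)
  exact h1.comp ((S.measurable_filt_chain h).prodMk (S.measurable_filt_innov h))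

lemma measurable_discount (t : ℕ) : Measurable[S.filt t] (S.discount t) :=
  Finset.measurable_fun_prod _ fun _ hi => S.measurable_beta (Finset.mem_Icc.1 hi).2

lemma measurable_consumption_of_assets {c : ℝ≥0 → Z → ℝ≥0} (hc : Feasible c) {a : ℝ≥0} {t : ℕ}
    (h : Measurable[S.filt t] (S.assets c a t)) : Measurable[S.filt t] (S.consumption c a t) :=
  hc.measurable_extend.comp (h.prodMk (S.measurable_filt_chain le_rfl))

lemma measurable_assets {c : ℝ≥0 → Z → ℝ≥0} (hc : Feasible c) (a : ℝ≥0) (t : ℕ) :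
    Measurable[S.filt t] (S.assets c a t) := by
  induction t with
  | zero => exact measurable_const
  | succ t ih =>
    have h1 := (ih.sub (S.measurable_consumption_of_assets hc ih)).mono
      (S.filt_mono t.le_succ) le_rfl
    exact ((S.measurable_ret le_rfl).mul h1).add (S.measurable_income le_rfl)

lemma measurable_consumption {c : ℝ≥0 → Z → ℝ≥0} (hc : Feasible c) (a : ℝ≥0) (t : ℕ) :
    Measurable[S.filt t] (S.consumption c a t) :=
  S.measurable_consumption_of_assets hc (S.measurable_assets hc a t)

lemma measurable_savings {c : ℝ≥0 → Z → ℝ≥0} (hc : Feasible c) (a : ℝ≥0) (t : ℕ) :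
    Measurable[S.filt t] (S.savings c a t) :=
  (S.measurable_assets hc a t).sub (S.measurable_consumption hc a t)

lemma consumption_le {c : ℝ≥0 → Z → ℝ≥0} (hc : Feasible c) (a : ℝ≥0) (t : ℕ) (ω : Ω) :
    S.consumption c a t ω ≤ S.assets c a t ω := extend_le hc _ _

lemma consumption_add_savings {c : ℝ≥0 → Z → ℝ≥0} (hc : Feasible c) (a : ℝ≥0) (t : ℕ) (ω : Ω) :
    S.consumption c a t ω + S.savings c a t ω = S.assets c a t ω :=
  add_tsub_cancel_of_le (S.consumption_le hc a t ω)

/-- The expected present value, conditional on `Z_0 = z`, of a payment `X` at time `t`. -/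
def pv (z : Z) (t : ℕ) (X : Ω → ℝ≥0∞) : ℝ≥0∞ := ∫⁻ ω, S.discount t ω * X ω ∂S.condOn z

lemma pv_mono {z : Z} {t : ℕ} {X X' : Ω → ℝ≥0∞} (h : ∀ ω, X ω ≤ X' ω) :
    S.pv z t X ≤ S.pv z t X' := by
  unfold pv
  gcongr with ω
  exact h ω

lemma measurable_discount_coe (t : ℕ) : Measurable fun ω => (S.discount t ω : ℝ≥0∞) :=
  ((S.measurable_discount t).mono (S.filt_le t) le_rfl).coe_nnreal_ennreal

lemma pv_add {z : Z} {t : ℕ} {X : Ω → ℝ≥0∞} (hX : Measurable X) (X' : Ω → ℝ≥0∞) :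
    S.pv z t (fun ω => X ω + X' ω) = S.pv z t X + S.pv z t X' := by
  simp only [pv, mul_add]
  exact lintegral_add_left ((S.measurable_discount_coe t).mul hX) _

lemma pv_const_mul {z : Z} {t : ℕ} (C : ℝ≥0∞) {X : Ω → ℝ≥0∞} (hX : Measurable X) :
    S.pv z t (fun ω => C * X ω) = C * S.pv z t X := by
  simp only [pv]
  refine Eq.trans ?_ (lintegral_const_mul C ((S.measurable_discount_coe t).mul hX))
  exact lintegral_congr fun ω => mul_left_comm _ _ _

lemma pv_zero [IsProbabilityMeasure μ] {z : Z} {X : Ω → ℝ≥0∞} {x : ℝ≥0∞}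
    (h : ∀ ω, S.chain 0 ω = z → X ω = x) : S.pv z 0 X = x := by
  have h1 : S.pv z 0 X = ∫⁻ _, x ∂S.condOn z := by
    refine lintegral_congr_ae ?_
    filter_upwards [S.condOn_chain_zero z] with ω hω
    rw [h ω hω, S.discount_zero]
    simp
  rw [h1]
  simp

/-- The Markov property for discounted payments: the new factor `β_{t+1}` is integrated together
with the payment. -/
lemma pv_succ [IsProbabilityMeasure μ] {T : Type*} [MeasurableSpace T] (z : Z) (t : ℕ)
    {H : Ω → T} (hH : Measurable[S.filt t] H) {F : T → Z → E₁ × E₂ × E₃ → ℝ≥0∞}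
    (hF : ∀ z, Measurable fun p : T × (E₁ × E₂ × E₃) => F p.1 z p.2) :
    S.pv z (t + 1) (fun ω => F (H ω) (S.chain (t + 1) ω) (S.innov (t + 1) ω)) =
      S.pv z t (fun ω => M.step (fun z' e => M.β z' e.1 * F (H ω) z' e) (S.chain t ω)) := by
  have hG z' : Measurable fun p : T × (E₁ × E₂ × E₃) => (M.β z' p.2.1 : ℝ≥0∞) * F p.1 z' p.2 := by
    have h1 := M.measurable_β z'
    have h2 := hF z'
    fun_prop
  have h := S.lintegral_condOn_next z t (T := ℝ≥0 × T) ((S.measurable_discount t).prodMk hH)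
    (F := fun p z' e => p.1 * (M.β z' e.1 * F p.2 z' e)) fun z' => by
      have h1 : Measurable fun p : (ℝ≥0 × T) × (E₁ × E₂ × E₃) => (p.1.1 : ℝ≥0∞) :=
        (measurable_fst.comp measurable_fst).coe_nnreal_ennreal
      exact h1.mul ((hG z').comp
        ((measurable_snd.comp measurable_fst).prodMk measurable_snd))
  refine Eq.trans ?_ (h.trans ?_)
  · refine lintegral_congr fun ω => ?_
    rw [S.discount_succ, ENNReal.coe_mul, mul_assoc]
    rfl
  · refine lintegral_congr fun ω => ?_
    exact M.step_const_mul (fun z' => (hG z').comp (measurable_const.prodMk measurable_id)) _ _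

/-- Weighted by the resolvent of `meanβ`, the discount factor loses in expectation exactly its
current unweighted value at each step. -/
lemma tsum_pv_one_ne_top [IsProbabilityMeasure μ] (hM : M.Regular) (z : Z) :
    ∑' t, S.pv z t (fun _ => 1) ≠ ⊤ := by
  let g := M.resolvent M.meanβ 1
  have hm : Measurable g := measurable_of_finite g
  have h t : S.pv z (t + 1) (fun ω => g (S.chain (t + 1) ω)) + S.pv z t (fun _ => 1) ≤
      S.pv z t (fun ω => g (S.chain t ω)) + 0 := by
    have h1 := S.pv_succ z t (T := Unit) (H := fun _ => ()) measurable_const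
      (F := fun _ z' _ => g z') fun _ => measurable_const
    simp_rw [M.step_β_mul_const g] at h1
    rw [h1, add_zero, ← S.pv_add]
    · refine S.pv_mono fun ω => ?_
      simp only [g]
      rw [M.resolvent_eq M.meanβ 1 (S.chain t ω), add_comm]
      rfl
    · exact (measurable_of_finite (M.transfer M.meanβ g)).comp (S.measurable_chain t)
  refine ne_top_of_le_ne_top ?_ (tsum_le_of_add_le h)
  rw [S.pv_zero (x := g z) fun ω hω => by rw [hω]]
  simpa using hM.resolvent_β z

lemma tsum_pv_const_ne_top [IsProbabilityMeasure μ] (hM : M.Regular) (z : Z) {C : ℝ≥0∞}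
    (hC : C ≠ ⊤) : ∑' t, S.pv z t (fun _ => C) ≠ ⊤ := by
  have h t : S.pv z t (fun _ => C) = C * S.pv z t (fun _ => 1) := by
    rw [← S.pv_const_mul C measurable_const, mul_one]
  simp_rw [h]
  rw [ENNReal.tsum_mul_left]
  exact ENNReal.mul_ne_top hC (S.tsum_pv_one_ne_top hM z)

/-- The Lyapunov function is wealth times the resolvent of `meanβ * meanR`. Savings never exceed
wealth, and income adds a bounded inflow whose discounted sum is finite. -/
lemma tsum_pv_assets_ne_top [IsProbabilityMeasure μ] (hM : M.Regular) {d : ℝ≥0 → Z → ℝ≥0}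
    (hd : Feasible d) (a : ℝ≥0) (z : Z) :
    ∑' t, S.pv z t (fun ω => S.assets d a t ω) ≠ ⊤ := by
  let h := M.resolvent (fun z => M.meanβ z * M.meanR z) 1
  let q : Z → ℝ≥0∞ := M.transfer M.meanβ fun z' => M.meanY z' * h z'
  have hq z : q z ≠ ⊤ := M.transfer_ne_top hM.meanβ_ne_top
    (fun z => ENNReal.mul_ne_top (hM.meanY_ne_top z) (hM.resolvent_βR z)) z
  let C := ∑ z, q z
  have hC : C ≠ ⊤ := ENNReal.sum_ne_top.2 fun z _ => hq z
  have hha t : Measurable fun ω => (S.assets d a t ω : ℝ≥0∞) :=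
    ((S.measurable_assets hd a t).mono (S.filt_le t) le_rfl).coe_nnreal_ennreal
  have hhc t : Measurable fun ω => h (S.chain t ω) :=
    (measurable_of_finite h).comp (S.measurable_chain t)
  have key t : S.pv z (t + 1) (fun ω => S.assets d a (t + 1) ω * h (S.chain (t + 1) ω)) +
      S.pv z t (fun ω => S.assets d a t ω) ≤
      S.pv z t (fun ω => S.assets d a t ω * h (S.chain t ω)) + S.pv z t (fun _ => C) := by
    have h1 := S.pv_succ z t (S.measurable_assets hd a t)
      (F := fun x z' e => (M.R z' e.2.1 : ℝ≥0∞) * (x * h z')) fun z' => by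
        have := M.measurable_R z'
        fun_prop
    have h2 := S.pv_succ z t (T := Unit) (H := fun _ => ()) measurable_const
      (F := fun _ z' e => (M.Y z' e.2.2 : ℝ≥0∞) * h z') fun z' => by
        have := M.measurable_Y z'
        fun_prop
    simp_rw [← mul_assoc (M.β _ _ : ℝ≥0∞), M.step_β_R_mul] at h1
    simp_rw [M.step_β_mul (h := fun z' y => (M.Y z' y : ℝ≥0∞) * h z')
      (fun z' => (M.measurable_Y z').coe_nnreal_ennreal.mul_const _)] at h2
    simp_rw [M.transfer_const_mul] at h1
    have h3 z' : ∫⁻ x, (M.Y z' x : ℝ≥0∞) * h z' ∂M.πη = M.meanY z' * h z' :=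
      lintegral_mul_const _ (M.measurable_Y z').coe_nnreal_ennreal
    simp_rw [h3] at h2
    have h4 : S.pv z (t + 1) (fun ω => S.assets d a (t + 1) ω * h (S.chain (t + 1) ω)) ≤
        S.pv z (t + 1) (fun ω =>
          (S.ret (t + 1) ω : ℝ≥0∞) * (S.assets d a t ω * h (S.chain (t + 1) ω)) +
          S.income (t + 1) ω * h (S.chain (t + 1) ω)) := by
      refine S.pv_mono fun ω => ?_
      rw [S.assets_succ, ENNReal.coe_add, ENNReal.coe_mul, add_mul, mul_assoc]
      gcongr
      exact tsub_le_self
    have hmr : Measurable fun ω => (S.ret (t + 1) ω : ℝ≥0∞) :=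
      ((S.measurable_ret le_rfl).mono (S.filt_le (t + 1)) le_rfl).coe_nnreal_ennreal
    have hma := hha t
    have hmc := hhc (t + 1)
    have h5 := h4.trans_eq
      ((S.pv_add (hmr.mul (hma.mul hmc)) _).trans (congrArg₂ (· + ·) h1 h2))
    calc _ ≤ S.pv z t (fun ω => S.assets d a t ω *
            M.transfer (fun z => M.meanβ z * M.meanR z) h (S.chain t ω)) +
          S.pv z t (fun ω => q (S.chain t ω)) + S.pv z t (fun ω => S.assets d a t ω) := by
            gcongr
      _ = S.pv z t (fun ω => S.assets d a t ω * h (S.chain t ω)) +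
          S.pv z t (fun ω => q (S.chain t ω)) := by
            rw [add_right_comm, ← S.pv_add]
            · congr 2
              funext ω
              simp only [h]
              rw [M.resolvent_eq _ _ (S.chain t ω)]
              simp only [Pi.one_apply]
              ring
            · exact (hha t).mul ((measurable_of_finite (M.transfer _ h)).comp
                (S.measurable_chain t))
      _ ≤ _ := by
            gcongr
            exact S.pv_mono fun ω =>
              Finset.single_le_sum (f := q) (fun _ _ => zero_le) (Finset.mem_univ _)
  refine ne_top_of_le_ne_top ?_ (tsum_le_of_add_le key)
  rw [S.pv_zero (x := a * h z) fun ω hω => by rw [hω, S.assets_zero]]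
  exact ENNReal.add_ne_top.2 ⟨ENNReal.mul_ne_top ENNReal.coe_ne_top (hM.resolvent_βR z),
    S.tsum_pv_const_ne_top hM z hC⟩

lemma tsum_pv_marginal_income_ne_top [IsProbabilityMeasure μ] (hM : M.Regular) (z : Z) :
    ∑' t, S.pv z (t + 1) (fun ω => M.marginal (S.income (t + 1) ω)) ≠ ⊤ := by
  let q : Z → ℝ≥0∞ := M.transfer M.meanβ M.meanMargY
  have hC : ∑ z, q z ≠ ⊤ := ENNReal.sum_ne_top.2 fun z _ =>
    M.transfer_ne_top hM.meanβ_ne_top hM.meanMargY_ne_top z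
  refine ne_top_of_le_ne_top (S.tsum_pv_const_ne_top hM z hC) (ENNReal.tsum_le_tsum fun t => ?_)
  have h1 := S.pv_succ z t (T := Unit) (H := fun _ => ()) measurable_const
    (F := fun _ z' e => M.marginal (M.Y z' e.2.2)) fun z' =>
      (M.measurable_marginal_Y z').comp
        (measurable_snd.comp (measurable_snd.comp measurable_snd))
  simp_rw [M.step_β_mul (h := fun z' y => M.marginal (M.Y z' y)) M.measurable_marginal_Y] at h1
  refine h1.trans_le (S.pv_mono fun ω => ?_)
  exact Finset.single_le_sum (f := q) (fun _ _ => zero_le) (Finset.mem_univ _)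

end Shocks

/-! ### Comparison of extended values; consequences of the Euler equation -/

lemma EReal_sub_le_sub {p₁ n₁ p₂ n₂ : ℝ≥0∞} (hp₁ : p₁ ≠ ⊤) (hp₂ : p₂ ≠ ⊤)
    (h : p₁ + n₂ ≤ p₂ + n₁) : (p₁ : EReal) - n₁ ≤ (p₂ : EReal) - n₂ := by
  lift p₁ to ℝ≥0 using hp₁
  lift p₂ to ℝ≥0 using hp₂
  induction n₁ with
  | top => simp
  | coe n₁ =>
    induction n₂ with
    | top => simp at h
    | coe n₂ =>
      norm_cast at h
      have h' : (p₁ : ℝ) + n₂ ≤ p₂ + n₁ := by exact_mod_cast h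
      have h2 : (p₁ : ℝ) - n₁ ≤ p₂ - n₂ := by linarith
      exact EReal.coe_le_coe_iff.2 h2

lemma EReal_not_sub_le_sub {p₁ n₁ p₂ n₂ δ : ℝ≥0∞} (hp₁ : p₁ ≠ ⊤) (hp₂ : p₂ ≠ ⊤)
    (hn₂ : n₂ ≠ ⊤) (hδ : 0 < δ) (h : p₁ + n₂ + δ ≤ p₂ + n₁) :
    ¬ (p₂ : EReal) - n₂ ≤ (p₁ : EReal) - n₁ := by
  lift p₁ to ℝ≥0 using hp₁
  lift p₂ to ℝ≥0 using hp₂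
  lift n₂ to ℝ≥0 using hn₂
  induction n₁ with
  | top =>
    simp only [EReal.coe_ennreal_top, EReal.sub_top, not_le]
    exact EReal.bot_lt_coe ((p₂ : ℝ) - n₂)
  | coe n₁ =>
    have hδt : δ ≠ ⊤ := by
      rintro rfl
      simp at h
    lift δ to ℝ≥0 using hδt
    norm_cast at h
    have hδ' : (0 : ℝ) < δ := by exact_mod_cast hδ
    have h' : (p₁ : ℝ) + n₂ + δ ≤ p₂ + n₁ := by exact_mod_cast h
    have h2 : (p₁ : ℝ) - n₁ < p₂ - n₂ := by linarith
    exact not_le.2 (EReal.coe_lt_coe_iff.2 h2)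

namespace Primitives

variable {Z E₁ E₂ E₃ : Type*} [Fintype Z] [MeasurableSpace Z]
    [MeasurableSingletonClass Z] [MeasurableSpace E₁] [MeasurableSpace E₂]
    [MeasurableSpace E₃] {M : Primitives Z E₁ E₂ E₃}

namespace IsRegularPolicy

variable {s : ℝ≥0} {c : ℝ≥0 → Z → ℝ≥0}

lemma feasible (hc : M.IsRegularPolicy s c) : Feasible c where
  measurable z := (hc.continuous z).measurable.comp measurable_subtype_coe
  le a z _ := hc.le a z

lemma extend_eq (hc : M.IsRegularPolicy s c) (a : ℝ≥0) (z : Z) : extend c a z = c a z := by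
  unfold extend
  split_ifs with h
  · rfl
  · have ha : a = 0 := by simpa using h
    subst ha
    exact (le_zero_iff.1 (hc.le 0 z)).symm

/-- Zero consumption would have infinite marginal utility, but `u'(a)` and the gap are finite. -/
lemma pos (hM : M.Regular) (hc : M.IsRegularPolicy s c) {a : ℝ≥0} (ha : 0 < a) (z : Z) :
    0 < c a z := by
  by_contra h
  have h0 : c a z = 0 := by simpa using h
  have h1 := hc.marginal_le a z
  rw [h0, M.marginal_zero, top_le_iff] at h1
  exact ENNReal.add_ne_top.2 ⟨M.marginal_ne_top ha, hM.gapBound_ne_top z⟩ h1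

lemma isCandidate (hM : M.Regular) (hc : M.IsRegularPolicy s c) : M.IsCandidate c where
  continuousOn z := (hc.continuous z).continuousOn
  monotoneOn z := (hc.mono z).monotoneOn _
  pos a z ha := hc.pos hM ha z
  le a z _ := hc.le a z
  bounded := by
    refine ⟨∑ z, (M.gapBound z).toReal, fun a z ha => ?_⟩
    have hcpos := hc.pos hM ha z
    have h1 : M.marginal a ≤ M.marginal (c a z) := M.strictAnti_marginal.antitone (hc.le a z)
    have h2 := hc.marginal_le a z
    rw [M.marginal_of_pos ha, M.marginal_of_pos hcpos] at h1 h2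
    rw [ENNReal.ofReal_le_ofReal_iff (M.du_pos (NNReal.coe_pos.2 hcpos)).le] at h1
    rw [← ENNReal.ofReal_toReal (hM.gapBound_ne_top z),
      ← ENNReal.ofReal_add (M.du_pos (NNReal.coe_pos.2 ha)).le ENNReal.toReal_nonneg,
      ENNReal.ofReal_le_ofReal_iff (add_nonneg (M.du_pos (NNReal.coe_pos.2 ha)).le
        ENNReal.toReal_nonneg)] at h2
    rw [abs_of_nonneg (sub_nonneg.2 h1)]
    have h3 := Finset.single_le_sum (f := fun z => (M.gapBound z).toReal)
      (fun _ _ => ENNReal.toReal_nonneg) (Finset.mem_univ z)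
    beta_reduce at h3
    linarith

end IsRegularPolicy

lemma IsEulerSol.marginalSaving_le {c : ℝ≥0 → Z → ℝ≥0} {a ξ : ℝ≥0} {z : Z}
    (h : M.IsEulerSol c a z ξ) : M.marginalSaving c (a - ξ) z ≤ M.marginal ξ := by
  rw [h.eq]
  exact le_max_left _ _

/-- Complementary slackness: either nothing is saved, or `ξ < a` and the maximum is attained by the
marginal value of saving. -/
lemma IsEulerSol.mul_marginalSaving {c : ℝ≥0 → Z → ℝ≥0} {a ξ : ℝ≥0} {z : Z}
    (h : M.IsEulerSol c a z ξ) :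
    ((a - ξ : ℝ≥0) : ℝ≥0∞) * M.marginalSaving c (a - ξ) z = ((a - ξ : ℝ≥0) : ℝ≥0∞) * M.marginal ξ := by
  rcases eq_or_lt_of_le h.le with rfl | hlt
  · simp
  · congr 1
    have h1 := M.strictAnti_marginal hlt
    have h2 := h.eq
    rcases max_choice (M.marginalSaving c (a - ξ) z) (M.marginal a) with h3 | h3
    · exact (h2.trans h3).symm
    · exact absurd (h2.trans h3) h1.ne'

end Primitives

/-! ### Budget inequality at marginal-utility prices and transversality -/

namespace Shocks

variable {Z E₁ E₂ E₃ : Type*} [Fintype Z] [MeasurableSpace Z]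
    [MeasurableSingletonClass Z] [MeasurableSpace E₁] [MeasurableSpace E₂]
    [MeasurableSpace E₃] {M : Primitives Z E₁ E₂ E₃}
    {Ω : Type*} [MeasurableSpace Ω] {μ : Measure Ω} (S : Shocks M μ)

/-- Marginal utility along the consumption path of `c`. -/
def margPath (c : ℝ≥0 → Z → ℝ≥0) (a : ℝ≥0) (t : ℕ) (ω : Ω) : ℝ≥0∞ :=
  M.marginal (S.consumption c a t ω)

lemma measurable_assets_coe {c : ℝ≥0 → Z → ℝ≥0} (hc : Feasible c) (a : ℝ≥0) (t : ℕ) :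
    Measurable fun ω => (S.assets c a t ω : ℝ≥0∞) :=
  ((S.measurable_assets hc a t).mono (S.filt_le t) le_rfl).coe_nnreal_ennreal

lemma measurable_consumption_coe {c : ℝ≥0 → Z → ℝ≥0} (hc : Feasible c) (a : ℝ≥0) (t : ℕ) :
    Measurable fun ω => (S.consumption c a t ω : ℝ≥0∞) :=
  ((S.measurable_consumption hc a t).mono (S.filt_le t) le_rfl).coe_nnreal_ennreal

lemma measurable_margPath {c : ℝ≥0 → Z → ℝ≥0} (hc : Feasible c) (a : ℝ≥0) (t : ℕ) :
    Measurable (S.margPath c a t) :=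
  M.measurable_marginal.comp ((S.measurable_consumption hc a t).mono (S.filt_le t) le_rfl)

lemma measurable_upos_consumption {c : ℝ≥0 → Z → ℝ≥0} (hc : Feasible c) (a : ℝ≥0) (t : ℕ) :
    Measurable fun ω => M.upos (S.consumption c a t ω) :=
  M.measurable_upos.comp ((S.measurable_consumption hc a t).mono (S.filt_le t) le_rfl)

lemma measurable_uneg_consumption {c : ℝ≥0 → Z → ℝ≥0} (hc : Feasible c) (a : ℝ≥0) (t : ℕ) :
    Measurable fun ω => M.uneg (S.consumption c a t ω) :=
  M.measurable_uneg.comp ((S.measurable_consumption hc a t).mono (S.filt_le t) le_rfl)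

lemma measurable_income' (t : ℕ) : Measurable (S.income t) :=
  (S.measurable_income le_rfl).mono (S.filt_le t) le_rfl

lemma savings_eq {s : ℝ≥0} {c : ℝ≥0 → Z → ℝ≥0} (hc : M.IsRegularPolicy s c)
    (a : ℝ≥0) (t : ℕ) (ω : Ω) :
    S.savings c a t ω = S.assets c a t ω - c (S.assets c a t ω) (S.chain t ω) := by
  rw [savings, consumption, hc.extend_eq]

lemma margPath_eq {s : ℝ≥0} {c : ℝ≥0 → Z → ℝ≥0} (hc : M.IsRegularPolicy s c)
    (a : ℝ≥0) (t : ℕ) (ω : Ω) :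
    S.margPath c a t ω = M.marginal (c (S.assets c a t ω) (S.chain t ω)) := by
  rw [margPath, consumption, hc.extend_eq]

/-- Value at date `t + 1` of the wealth generated by the savings of `d`, in units of marginal
utility along the path of `c`. -/
lemma pv_margPath_succ [IsProbabilityMeasure μ] {s : ℝ≥0} {c d : ℝ≥0 → Z → ℝ≥0}
    (hc : M.IsRegularPolicy s c) (hd : Feasible d) (a : ℝ≥0) (z : Z) (t : ℕ) :
    S.pv z (t + 1) (fun ω => S.margPath c a (t + 1) ω * S.assets d a (t + 1) ω) =
      S.pv z t (fun ω => S.savings d a t ω *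
        M.marginalSaving c (S.savings c a t ω) (S.chain t ω)) +
      S.pv z (t + 1) (fun ω => S.margPath c a (t + 1) ω * S.income (t + 1) ω) := by
  have hF z' : Measurable fun p : ℝ≥0 × (E₁ × E₂ × E₃) =>
      M.marginal (c (M.R z' p.2.2.1 * p.1 + M.Y z' p.2.2.2) z') := by
    have h1 := M.measurable_R z'
    have h2 := M.measurable_Y z'
    exact (M.measurable_marginal.comp (hc.continuous z').measurable).comp
      (by fun_prop : Measurable fun p : ℝ≥0 × (E₁ × E₂ × E₃) =>
        M.R z' p.2.2.1 * p.1 + M.Y z' p.2.2.2)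
  have hG z' : Measurable fun p : (ℝ≥0 × ℝ≥0) × (E₁ × E₂ × E₃) =>
      (p.1.2 : ℝ≥0∞) * (M.R z' p.2.2.1 *
        M.marginal (c (M.R z' p.2.2.1 * p.1.1 + M.Y z' p.2.2.2) z')) := by
    have h1 := M.measurable_R z'
    have h3 := (hF z').comp (by fun_prop : Measurable fun p : (ℝ≥0 × ℝ≥0) × (E₁ × E₂ × E₃) =>
      (p.1.1, p.2))
    exact Measurable.mul (by fun_prop) (Measurable.mul (by fun_prop) h3)
  have h1 := S.pv_succ z t ((S.measurable_savings hc.feasible a t).prodMk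
    (S.measurable_savings hd a t)) (F := fun p z' e => (p.2 : ℝ≥0∞) * (M.R z' e.2.1 *
      M.marginal (c (M.R z' e.2.1 * p.1 + M.Y z' e.2.2) z'))) hG
  have h2 : ∀ k l : ℝ≥0, ∀ z, M.step (fun z' e => (M.β z' e.1 : ℝ≥0∞) * ((l : ℝ≥0∞) *
      (M.R z' e.2.1 * M.marginal (c (M.R z' e.2.1 * k + M.Y z' e.2.2) z')))) z =
      l * M.marginalSaving c k z := by
    intro k l z
    rw [Primitives.marginalSaving, ← M.step_const_mul]
    · congr 1
      funext z' e
      ring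
    · intro z'
      have h3 := (hF z').comp (measurable_const (a := k).prodMk measurable_id)
      have h4 := M.measurable_R z'
      have h5 := M.measurable_β z'
      exact Measurable.mul (by fun_prop) h3
  simp_rw [h2] at h1
  rw [← h1, ← S.pv_add]
  · congr 1
    funext ω
    rw [S.assets_succ d, S.margPath_eq hc, S.assets_succ c, ENNReal.coe_add, ENNReal.coe_mul,
      mul_add]
    congr 1
    change _ = (S.savings d a t ω : ℝ≥0∞) * (S.ret (t + 1) ω * _)
    rw [mul_comm, mul_assoc, mul_left_comm]
    rfl
  · have h6 : Measurable fun p : ((ℝ≥0 × ℝ≥0) × (E₁ × E₂ × E₃)) × Z =>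
      (p.1.1.2 : ℝ≥0∞) * (M.R p.2 p.1.2.2.1 *
        M.marginal (c (M.R p.2 p.1.2.2.1 * p.1.1.1 + M.Y p.2 p.1.2.2.2) p.2)) :=
      measurable_from_prod_countable_left hG
    refine h6.comp (Measurable.prodMk (Measurable.prodMk (Measurable.prodMk ?_ ?_) ?_) ?_)
    · exact (S.measurable_savings hc.feasible a t).mono (S.filt_le t) le_rfl
    · exact (S.measurable_savings hd a t).mono (S.filt_le t) le_rfl
    · exact S.measurable_innov (t + 1)
    · exact S.measurable_chain (t + 1)

/-- Budget constraint of `d` in units of marginal utility along the path of `c`. -/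
lemma sum_pv_consumption_le [IsProbabilityMeasure μ] {s : ℝ≥0} {c d : ℝ≥0 → Z → ℝ≥0}
    (hc : M.IsRegularPolicy s c) (hE : ∀ a z, M.IsEulerSol c a z (c a z)) (hd : Feasible d)
    (a : ℝ≥0) (z : Z) (n : ℕ) :
    ∑ t ∈ Finset.range n, S.pv z t (fun ω => S.margPath c a t ω * S.consumption d a t ω) +
        S.pv z n (fun ω => S.margPath c a n ω * S.assets d a n ω) ≤
      ∑ t ∈ Finset.range n, S.pv z t (fun ω => S.margPath c a t ω * S.consumption c a t ω) +
        S.pv z n (fun ω => S.margPath c a n ω * S.assets c a n ω) := by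
  induction n with
  | zero => exact le_rfl
  | succ n ih =>
    have hsplit {d : ℝ≥0 → Z → ℝ≥0} (hd : Feasible d) :
        S.pv z n (fun ω => S.margPath c a n ω * S.consumption d a n ω) +
          S.pv z n (fun ω => S.savings d a n ω * S.margPath c a n ω) =
        S.pv z n (fun ω => S.margPath c a n ω * S.assets d a n ω) := by
      refine (S.pv_add ((S.measurable_margPath hc.feasible a n).mul
        (S.measurable_consumption_coe hd a n)) _).symm.trans ?_
      congr 1
      funext ω
      rw [Pi.mul_apply]
      rw [← S.consumption_add_savings hd, ENNReal.coe_add]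
      ring
    -- For arbitrary savings the Euler equation gives only an inequality. For the savings of `c`
    -- itself, complementary slackness makes it an equality, so the comparison survives the step.
    have h1 : S.pv z n (fun ω => S.savings d a n ω *
        M.marginalSaving c (S.savings c a n ω) (S.chain n ω)) ≤
        S.pv z n (fun ω => S.savings d a n ω * S.margPath c a n ω) := by
      refine S.pv_mono fun ω => ?_
      gcongr
      rw [S.savings_eq hc, S.margPath_eq hc]
      exact (hE _ _).marginalSaving_le
    have h2 : S.pv z n (fun ω => S.savings c a n ω *
        M.marginalSaving c (S.savings c a n ω) (S.chain n ω)) =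
        S.pv z n (fun ω => S.savings c a n ω * S.margPath c a n ω) := by
      congr 1
      funext ω
      rw [S.savings_eq hc, S.margPath_eq hc]
      exact (hE _ _).mul_marginalSaving
    rw [Finset.sum_range_succ, Finset.sum_range_succ, S.pv_margPath_succ hc hd,
      S.pv_margPath_succ hc hc.feasible, h2]
    set y := S.pv z (n + 1) (fun ω => S.margPath c a (n + 1) ω * S.income (n + 1) ω)
    calc _ ≤ ∑ t ∈ Finset.range n,
            S.pv z t (fun ω => S.margPath c a t ω * S.consumption d a t ω) +
          S.pv z n (fun ω => S.margPath c a n ω * S.consumption d a n ω) +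
          (S.pv z n (fun ω => S.savings d a n ω * S.margPath c a n ω) + y) := by gcongr
      _ = ∑ t ∈ Finset.range n,
            S.pv z t (fun ω => S.margPath c a t ω * S.consumption d a t ω) +
          S.pv z n (fun ω => S.margPath c a n ω * S.assets d a n ω) + y := by
            rw [← hsplit hd]; ring
      _ ≤ ∑ t ∈ Finset.range n,
            S.pv z t (fun ω => S.margPath c a t ω * S.consumption c a t ω) +
          S.pv z n (fun ω => S.margPath c a n ω * S.assets c a n ω) + y := by gcongr
      _ = _ := by rw [← hsplit hc.feasible]; ring

/-- Up to the gap, the product is `u'(x) x` for wealth `x`. When `x ≤ 1` it is at most `u'(Y)`, as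
wealth is at least income; when `x ≥ 1` it is at most `u'(1) x`. Dates start at `t + 1` because
initial wealth contains no income. -/
lemma margPath_mul_assets_le {s : ℝ≥0} {c : ℝ≥0 → Z → ℝ≥0} (hc : M.IsRegularPolicy s c)
    (a : ℝ≥0) (t : ℕ) (ω : Ω) :
    S.margPath c a (t + 1) ω * S.assets c a (t + 1) ω ≤
      M.marginal (S.income (t + 1) ω) +
        (M.marginal 1 + ∑ z, M.gapBound z) * S.assets c a (t + 1) ω := by
  rw [S.margPath_eq hc]
  set x := S.assets c a (t + 1) ω
  have hx : M.marginal x ≤ M.marginal (S.income (t + 1) ω) :=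
    M.strictAnti_marginal.antitone (by simp only [x]; rw [S.assets_succ]; exact le_add_self)
  have h1 : M.marginal x * x ≤ M.marginal (S.income (t + 1) ω) + M.marginal 1 * x := by
    rcases le_total x 1 with h | h
    · calc M.marginal x * x ≤ M.marginal (S.income (t + 1) ω) * 1 := by
            gcongr
            exact_mod_cast h
        _ ≤ _ := by rw [mul_one]; exact le_self_add
    · refine le_trans ?_ le_add_self
      gcongr
      exact M.strictAnti_marginal.antitone h
  calc M.marginal (c x (S.chain (t + 1) ω)) * x
      ≤ (M.marginal x + ∑ z, M.gapBound z) * x := by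
        gcongr
        refine (hc.marginal_le _ _).trans ?_
        gcongr
        exact Finset.single_le_sum (f := M.gapBound) (fun _ _ => zero_le) (Finset.mem_univ _)
    _ = M.marginal x * x + (∑ z, M.gapBound z) * x := add_mul _ _ _
    _ ≤ M.marginal (S.income (t + 1) ω) + M.marginal 1 * x + (∑ z, M.gapBound z) * x := by gcongr
    _ = _ := by ring

/-- Transversality in summable form: the terms of a finite sum tend to `0`, which removes the
terminal wealth term. -/
lemma tsum_pv_margPath_assets_ne_top [IsProbabilityMeasure μ] {s : ℝ≥0} {c : ℝ≥0 → Z → ℝ≥0}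
    (hc : M.IsRegularPolicy s c) (hM : M.Regular) (a : ℝ≥0) (z : Z) :
    ∑' t, S.pv z (t + 1) (fun ω => S.margPath c a (t + 1) ω * S.assets c a (t + 1) ω) ≠ ⊤ := by
  set C := M.marginal 1 + ∑ z, M.gapBound z
  have hC : C ≠ ⊤ := ENNReal.add_ne_top.2 ⟨M.marginal_ne_top one_pos,
    ENNReal.sum_ne_top.2 fun z _ => hM.gapBound_ne_top z⟩
  have h1 t : S.pv z (t + 1) (fun ω => S.margPath c a (t + 1) ω * S.assets c a (t + 1) ω) ≤
      S.pv z (t + 1) (fun ω => M.marginal (S.income (t + 1) ω)) +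
        C * S.pv z (t + 1) (fun ω => S.assets c a (t + 1) ω) := by
    rw [← S.pv_const_mul C (S.measurable_assets_coe hc.feasible a (t + 1)), ← S.pv_add]
    · exact S.pv_mono fun ω => S.margPath_mul_assets_le hc a t ω
    · exact M.measurable_marginal.comp (S.measurable_income' (t + 1))
  refine ne_top_of_le_ne_top ?_ (ENNReal.tsum_le_tsum h1)
  rw [ENNReal.tsum_add, ENNReal.tsum_mul_left]
  refine ENNReal.add_ne_top.2 ⟨S.tsum_pv_marginal_income_ne_top hM z, ENNReal.mul_ne_top hC ?_⟩
  refine ne_top_of_le_ne_top (S.tsum_pv_assets_ne_top hM hc.feasible a z) ?_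
  rw [tsum_eq_zero_add' (f := fun t => S.pv z t _) ENNReal.summable]
  exact le_add_self

end Shocks

/-! ### Lifetime values, optimality and uniqueness -/

namespace Shocks

variable {Z E₁ E₂ E₃ : Type*} [Fintype Z] [MeasurableSpace Z]
    [MeasurableSingletonClass Z] [MeasurableSpace E₁] [MeasurableSpace E₂]
    [MeasurableSpace E₃] {M : Primitives Z E₁ E₂ E₃}
    {Ω : Type*} [MeasurableSpace Ω] {μ : Measure Ω} (S : Shocks M μ)

/-- The positive part of lifetime value. -/
def valuePos (c : ℝ≥0 → Z → ℝ≥0) (a : ℝ≥0) (z : Z) : ℝ≥0∞ :=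
  ∑' t, S.pv z t (fun ω => M.upos (S.consumption c a t ω))

/-- The negative part of lifetime value. -/
def valueNeg (c : ℝ≥0 → Z → ℝ≥0) (a : ℝ≥0) (z : Z) : ℝ≥0∞ :=
  ∑' t, S.pv z t (fun ω => M.uneg (S.consumption c a t ω))

lemma value_eq {c : ℝ≥0 → Z → ℝ≥0} (hc : Feasible c) (a : ℝ≥0) (z : Z) :
    S.value c a z = (S.valuePos c a z : EReal) - S.valueNeg c a z := by
  rw [value, lintegral_tsum, lintegral_tsum]
  · rfl
  · exact fun t => ((S.measurable_discount_coe t).mul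
      (S.measurable_uneg_consumption hc a t)).aemeasurable
  · exact fun t => ((S.measurable_discount_coe t).mul
      (S.measurable_upos_consumption hc a t)).aemeasurable

lemma valuePos_ne_top [IsProbabilityMeasure μ] (hM : M.Regular) {d : ℝ≥0 → Z → ℝ≥0}
    (hd : Feasible d) (a : ℝ≥0) (z : Z) : S.valuePos d a z ≠ ⊤ := by
  have h1 t : S.pv z t (fun ω => M.upos (S.consumption d a t ω)) ≤
      S.pv z t (fun _ => M.upos 1) + M.marginal 1 * S.pv z t (fun ω => S.assets d a t ω) := by
    rw [← S.pv_const_mul _ (S.measurable_assets_coe hd a t), ← S.pv_add measurable_const]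
    refine S.pv_mono fun ω => (M.upos_le _).trans ?_
    gcongr
    exact S.consumption_le hd a t ω
  refine ne_top_of_le_ne_top ?_ (ENNReal.tsum_le_tsum h1)
  rw [ENNReal.tsum_add, ENNReal.tsum_mul_left]
  exact ENNReal.add_ne_top.2 ⟨S.tsum_pv_const_ne_top hM z (M.upos_ne_top 1),
    ENNReal.mul_ne_top (M.marginal_ne_top one_pos) (S.tsum_pv_assets_ne_top hM hd a z)⟩

/-- Consuming everything gives a value above `-∞`. -/
lemma valueNeg_id_ne_top [IsProbabilityMeasure μ] (hM : M.Regular) {a : ℝ≥0} (ha : 0 < a) (z : Z) :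
    S.valueNeg (fun a _ => a) a z ≠ ⊤ := by
  have hext : ∀ x : ℝ≥0, ∀ z : Z, extend (fun a _ => a) x z = x := by
    intro x z
    unfold extend
    split_ifs with h
    · rfl
    · exact (not_lt.1 h).antisymm zero_le |>.symm
  have hcons t ω : S.consumption (fun a _ => a) a t ω = S.assets (fun a _ => a) a t ω := hext _ _
  rw [valueNeg, tsum_eq_zero_add' ENNReal.summable]
  refine ENNReal.add_ne_top.2 ⟨?_, ?_⟩
  · rw [S.pv_zero (x := M.uneg a) fun ω _ => by rw [hcons, assets_zero]]
    exact M.uneg_ne_top ha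
  · have h1 t : S.pv z (t + 1) (fun ω => M.uneg (S.consumption (fun a _ => a) a (t + 1) ω)) ≤
        S.pv z (t + 1) (fun _ => M.uneg 1) +
          S.pv z (t + 1) (fun ω => M.marginal (S.income (t + 1) ω)) := by
      rw [← S.pv_add measurable_const]
      refine S.pv_mono fun ω => (M.uneg_le _).trans ?_
      gcongr
      refine M.strictAnti_marginal.antitone ?_
      rw [hcons, assets_succ]
      exact le_add_self
    refine ne_top_of_le_ne_top ?_ (ENNReal.tsum_le_tsum h1)
    rw [ENNReal.tsum_add]
    refine ENNReal.add_ne_top.2 ⟨?_, S.tsum_pv_marginal_income_ne_top hM z⟩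
    refine ne_top_of_le_ne_top (S.tsum_pv_const_ne_top hM z (M.uneg_ne_top one_pos)) ?_
    rw [tsum_eq_zero_add' (f := fun t => S.pv z t (fun _ => M.uneg 1)) ENNReal.summable]
    exact le_add_self

/-- Lifetime values are compared via the Euler equation and the transversality condition. -/
lemma valuePos_add_valueNeg_le [IsProbabilityMeasure μ] {s : ℝ≥0} {c d : ℝ≥0 → Z → ℝ≥0}
    (hM : M.Regular) (hc : M.IsRegularPolicy s c) (hE : ∀ a z, M.IsEulerSol c a z (c a z))
    (hd : Feasible d) {a : ℝ≥0} (ha : 0 < a) (z : Z) {δ : ℝ≥0∞}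
    (hδ : M.upos (d a z) + M.uneg (c a z) + M.marginal (c a z) * c a z + δ ≤
      M.upos (c a z) + M.uneg (d a z) + M.marginal (c a z) * d a z) :
    S.valuePos d a z + S.valueNeg c a z + δ ≤ S.valuePos c a z + S.valueNeg d a z := by
  let p (c : ℝ≥0 → Z → ℝ≥0) (t : ℕ) := S.pv z t (fun ω => M.upos (S.consumption c a t ω))
  let n (c : ℝ≥0 → Z → ℝ≥0) (t : ℕ) := S.pv z t (fun ω => M.uneg (S.consumption c a t ω))
  let q (d : ℝ≥0 → Z → ℝ≥0) (t : ℕ) :=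
    S.pv z t (fun ω => S.margPath c a t ω * S.consumption d a t ω)
  let b (t : ℕ) := S.pv z t (fun ω => S.margPath c a t ω * S.assets c a t ω)
  have hb0 : b 0 ≠ ⊤ := by
    simp only [b]
    rw [S.pv_zero (x := M.marginal (c a z) * a) fun ω hω => by
      rw [S.margPath_eq hc, assets_zero, hω]]
    exact ENNReal.mul_ne_top (M.marginal_ne_top (hc.pos hM ha z)) ENNReal.coe_ne_top
  have hbs := S.tsum_pv_margPath_assets_ne_top hc hM a z
  have hb t : b t ≠ ⊤ := by
    cases t with
    | zero => exact hb0
    | succ t => exact ENNReal.ne_top_of_tsum_ne_top hbs t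
  have hqc t : q c t ≠ ⊤ := by
    refine ne_top_of_le_ne_top (hb t) (S.pv_mono fun ω => ?_)
    gcongr
    exact S.consumption_le hc.feasible a t ω
  have hmp {d} (hd : Feasible d) t := S.measurable_upos_consumption hd a t
  have hmn {d} (hd : Feasible d) t := S.measurable_uneg_consumption hd a t
  have hsum {d e : ℝ≥0 → Z → ℝ≥0} (hd : Feasible d) (he : Feasible e) (x : ℝ≥0 → Z → ℝ≥0)
      (t : ℕ) : p d t + n e t + q x t = S.pv z t (fun ω => M.upos (S.consumption d a t ω) +
        M.uneg (S.consumption e a t ω) + S.margPath c a t ω * S.consumption x a t ω) := by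
    exact ((S.pv_add ((hmp hd t).add (hmn he t)) _).trans
      (congrArg (· + q x t) (S.pv_add (hmp hd t) _))).symm
  have hstep t : p d t + n c t + q c t ≤ p c t + n d t + q d t := by
    rw [hsum hd hc.feasible, hsum hc.feasible hd]
    exact S.pv_mono fun ω => M.tangent_le _ _
  -- The state at date 0 is deterministic under the conditional law, so a strict tangent gap there
  -- enters the sum undiminished.
  have hstep0 : p d 0 + n c 0 + q c 0 + δ ≤ p c 0 + n d 0 + q d 0 := by
    have hcons (e : ℝ≥0 → Z → ℝ≥0) ω (hω : S.chain 0 ω = z) :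
        S.consumption e a 0 ω = e a z := by
      rw [consumption, assets_zero, hω]
      exact if_pos ha
    have h1 (e : ℝ≥0 → Z → ℝ≥0) (f : ℝ≥0 → ℝ≥0∞) :
        S.pv z 0 (fun ω => f (S.consumption e a 0 ω)) = f (e a z) :=
      S.pv_zero fun ω hω => by rw [hcons e ω hω]
    have h2 (e : ℝ≥0 → Z → ℝ≥0) : q e 0 = M.marginal (c a z) * e a z :=
      S.pv_zero fun ω hω => by rw [margPath, hcons e ω hω, hcons c ω hω]
    simp only [p, n]
    rw [h2, h2, h1, h1, h1, h1]
    exact hδ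
  have hmain T : ∑ t ∈ Finset.range (T + 1), p d t + ∑ t ∈ Finset.range (T + 1), n c t + δ ≤
      ∑ t ∈ Finset.range (T + 1), p c t + ∑ t ∈ Finset.range (T + 1), n d t + b (T + 1) := by
    have h1 : ∑ t ∈ Finset.range (T + 1), (p d t + n c t + q c t) + δ ≤
        ∑ t ∈ Finset.range (T + 1), (p c t + n d t + q d t) := by
      rw [Finset.sum_range_succ', Finset.sum_range_succ', add_assoc]
      exact add_le_add (Finset.sum_le_sum fun t _ => hstep (t + 1)) hstep0
    have h2 : ∑ t ∈ Finset.range (T + 1), q d t ≤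
        ∑ t ∈ Finset.range (T + 1), q c t + b (T + 1) :=
      le_self_add.trans (S.sum_pv_consumption_le hc hE hd a z (T + 1))
    simp only [Finset.sum_add_distrib] at h1
    -- The expenditure of `c` appears on both sides and can be cancelled only because it is finite.
    have hqfin : ∑ t ∈ Finset.range (T + 1), q c t ≠ ⊤ := ENNReal.sum_ne_top.2 fun t _ => hqc t
    refine (ENNReal.add_le_add_iff_right hqfin).1 ?_
    calc _ = ∑ t ∈ Finset.range (T + 1), p d t + ∑ t ∈ Finset.range (T + 1), n c t +
          ∑ t ∈ Finset.range (T + 1), q c t + δ := by ring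
      _ ≤ _ := h1
      _ ≤ ∑ t ∈ Finset.range (T + 1), p c t + ∑ t ∈ Finset.range (T + 1), n d t +
          (∑ t ∈ Finset.range (T + 1), q c t + b (T + 1)) := by gcongr
      _ = _ := by ring
  have hlim (f : ℕ → ℝ≥0∞) :
      Tendsto (fun T => ∑ t ∈ Finset.range (T + 1), f t) atTop (𝓝 (∑' t, f t)) :=
    (ENNReal.tendsto_nat_tsum f).comp (tendsto_add_atTop_nat 1)
  have hblim : Tendsto (fun T => b (T + 1)) atTop (𝓝 0) :=
    ENNReal.tendsto_atTop_zero_of_tsum_ne_top hbs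
  have h := le_of_tendsto_of_tendsto' (((hlim (p d)).add (hlim (n c))).add_const δ)
    (((hlim (p c)).add (hlim (n d))).add hblim) hmain
  rwa [add_zero] at h

/-- Comparison with consuming everything, whose value is above `-∞`. -/
lemma valueNeg_ne_top [IsProbabilityMeasure μ] {s : ℝ≥0} {c : ℝ≥0 → Z → ℝ≥0}
    (hM : M.Regular) (hc : M.IsRegularPolicy s c) (hE : ∀ a z, M.IsEulerSol c a z (c a z))
    {a : ℝ≥0} (ha : 0 < a) (z : Z) : S.valueNeg c a z ≠ ⊤ := by
  have h := S.valuePos_add_valueNeg_le hM hc hE (M.isRegularPolicy_id s).feasible ha z (δ := 0)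
    (by rw [add_zero]; exact M.tangent_le _ _)
  rw [add_zero] at h
  exact ne_top_of_le_ne_top (ENNReal.add_ne_top.2 ⟨S.valuePos_ne_top hM hc.feasible a z,
    S.valueNeg_id_ne_top hM ha z⟩) (le_add_self.trans h)

/-- A policy satisfying the Euler equation is optimal. -/
theorem isOptimal_of_isEulerSol [IsProbabilityMeasure μ] {s : ℝ≥0} {c : ℝ≥0 → Z → ℝ≥0}
    (hM : M.Regular) (hc : M.IsRegularPolicy s c) (hE : ∀ a z, M.IsEulerSol c a z (c a z)) :
    S.IsOptimal c := by
  refine ⟨hc.feasible, fun d hd a z ha => ?_⟩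
  rw [S.value_eq hd, S.value_eq hc.feasible]
  refine EReal_sub_le_sub (S.valuePos_ne_top hM hd a z)
    (S.valuePos_ne_top hM hc.feasible a z) ?_
  simpa using S.valuePos_add_valueNeg_le hM hc hE hd ha z (δ := 0)
    (by rw [add_zero]; exact M.tangent_le _ _)

/-- The optimal policy is unique among policies with positive consumption. -/
theorem eq_of_isOptimal [IsProbabilityMeasure μ] {s : ℝ≥0} {c d : ℝ≥0 → Z → ℝ≥0}
    (hM : M.Regular) (hc : M.IsRegularPolicy s c) (hE : ∀ a z, M.IsEulerSol c a z (c a z))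
    (hd : S.IsOptimal d) {a : ℝ≥0} {z : Z} (ha : 0 < a) (hpos : 0 < d a z) : d a z = c a z := by
  by_contra hne
  -- Strict concavity: a different positive consumption at date 0 costs `δ > 0`, so `c` would beat
  -- `d` strictly.
  obtain ⟨δ, hδ, h⟩ := M.tangent_strict (hc.pos hM ha z) hpos (Ne.symm hne)
  have h1 := S.valuePos_add_valueNeg_le hM hc hE hd.1 ha z h
  have h2 := hd.2 c hc.feasible a z ha
  rw [S.value_eq hd.1, S.value_eq hc.feasible] at h2
  exact EReal_not_sub_le_sub (S.valuePos_ne_top hM hd.1 a z)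
    (S.valuePos_ne_top hM hc.feasible a z) (S.valueNeg_ne_top hM hc hE ha z) hδ h1 h2

end Shocks

/-! ### Krylov–Bogoliubov under a drift condition -/

open scoped BoundedContinuousFunction

section KrylovBogoliubov

variable {X : Type*} [MeasurableSpace X]

/-- The average of the first `n + 1` laws of the chain with kernel `κ` started at `x`. -/
def cesaro (κ : Kernel X X) (x : X) (n : ℕ) : Measure X :=
  ((n : ℝ≥0∞) + 1)⁻¹ • ∑ i ∈ Finset.range (n + 1), (fun ν => ν.bind κ)^[i] (Measure.dirac x)

lemma lintegral_cesaro (κ : Kernel X X) (x : X) (n : ℕ) (f : X → ℝ≥0∞) :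
    ∫⁻ y, f y ∂cesaro κ x n = ((n : ℝ≥0∞) + 1)⁻¹ *
      ∑ i ∈ Finset.range (n + 1), ∫⁻ y, f y ∂(fun ν => ν.bind κ)^[i] (Measure.dirac x) := by
  rw [cesaro, lintegral_smul_measure, lintegral_finsetSum_measure, smul_eq_mul]

lemma isProbabilityMeasure_iterate_bind (κ : Kernel X X) [IsMarkovKernel κ] (x : X) (i : ℕ) :
    IsProbabilityMeasure ((fun ν : Measure X => ν.bind κ)^[i] (Measure.dirac x)) := by
  induction i with
  | zero => exact Measure.dirac.isProbabilityMeasure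
  | succ i ih =>
    rw [Function.iterate_succ_apply']
    infer_instance

lemma natCast_add_one_inv_mul (n : ℕ) : ((n : ℝ≥0∞) + 1)⁻¹ * (n + 1) = 1 :=
  ENNReal.inv_mul_cancel (by simp) (by simp)

instance (κ : Kernel X X) [IsMarkovKernel κ] (x : X) (n : ℕ) :
    IsProbabilityMeasure (cesaro κ x n) := by
  constructor
  have h := lintegral_cesaro κ x n (fun _ => 1)
  simp only [lintegral_const, one_mul] at h
  rw [h]
  have h1 i := (isProbabilityMeasure_iterate_bind κ x i).measure_univ
  simp only [h1, Finset.sum_const, Finset.card_range, nsmul_eq_mul, mul_one, Nat.cast_add,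
    Nat.cast_one]
  exact natCast_add_one_inv_mul n

lemma lintegral_iterate_succ (κ : Kernel X X) (x : X) (i : ℕ) {f : X → ℝ≥0∞} (hf : Measurable f) :
    ∫⁻ y, f y ∂(fun ν : Measure X => ν.bind κ)^[i + 1] (Measure.dirac x) =
      ∫⁻ y, ∫⁻ w, f w ∂κ y ∂(fun ν : Measure X => ν.bind κ)^[i] (Measure.dirac x) := by
  rw [Function.iterate_succ_apply', Measure.lintegral_bind κ.measurable.aemeasurable
    hf.aemeasurable]

/-- One application of the kernel shifts the average by one index, changing only its two end terms,
each of weight `1 / (n + 1)`. -/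
lemma lintegral_cesaro_bind (κ : Kernel X X) (x : X) (n : ℕ) {f : X → ℝ≥0∞} (hf : Measurable f) :
    ∫⁻ y, ∫⁻ w, f w ∂κ y ∂cesaro κ x n + ((n : ℝ≥0∞) + 1)⁻¹ * f x =
      ∫⁻ y, f y ∂cesaro κ x n + ((n : ℝ≥0∞) + 1)⁻¹ *
        ∫⁻ y, f y ∂(fun ν : Measure X => ν.bind κ)^[n + 1] (Measure.dirac x) := by
  have h0 : f x = ∫⁻ y, f y ∂(fun ν : Measure X => ν.bind κ)^[0] (Measure.dirac x) :=
    (lintegral_dirac' x hf).symm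
  rw [h0, lintegral_cesaro, lintegral_cesaro, ← mul_add, ← mul_add]
  simp_rw [← lintegral_iterate_succ κ x _ hf]
  congr 1
  exact (Finset.sum_range_succ'
    (fun i => ∫⁻ y, f y ∂(fun ν : Measure X => ν.bind κ)^[i] (Measure.dirac x)) (n + 1)).symm.trans
    (Finset.sum_range_succ _ _)

/-- A Feller kernel with a Foster-Lyapunov drift towards compact sets has an invariant
probability measure. -/
theorem exists_invariant_of_drift [TopologicalSpace X] [T2Space X] [BorelSpace X]
    [HasOuterApproxClosed X] (κ : Kernel X X) [IsMarkovKernel κ]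
    (hκ : ∀ f : X →ᵇ ℝ≥0, ∃ g : X →ᵇ ℝ≥0, ∀ x, (g x : ℝ≥0∞) = ∫⁻ y, f y ∂κ x)
    {V W : X → ℝ≥0∞} (hV : Measurable V) (hW : Measurable W) {b : ℝ≥0∞} (hb : b ≠ ⊤)
    (hdrift : ∀ x, ∫⁻ y, W y ∂κ x + V x ≤ W x + b) {x : X} (hx : W x ≠ ⊤)
    (hcpt : ∀ r : ℝ≥0, IsCompact {y | V y ≤ r}) :
    ∃ ψ : Measure X, IsProbabilityMeasure ψ ∧ κ.Invariant ψ := by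
  let ν : ℕ → Measure X := fun i => (fun ν : Measure X => ν.bind κ)^[i] (Measure.dirac x)
  have hν i : IsProbabilityMeasure (ν i) := isProbabilityMeasure_iterate_bind κ x i
  -- Telescoping the drift inequality bounds the average of `V` uniformly in `n`; Markov's
  -- inequality on its compact sublevel sets then gives tightness.
  have hVle n : ∫⁻ y, V y ∂cesaro κ x n ≤ W x + b := by
    have h1 i : ∫⁻ y, W y ∂ν (i + 1) + ∫⁻ y, V y ∂ν i ≤ ∫⁻ y, W y ∂ν i + b := by
      calc ∫⁻ y, W y ∂ν (i + 1) + ∫⁻ y, V y ∂ν i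
          = ∫⁻ y, (∫⁻ w, W w ∂κ y + V y) ∂ν i := by
            rw [lintegral_add_right _ hV, ← lintegral_iterate_succ κ x i hW]
        _ ≤ ∫⁻ y, (W y + b) ∂ν i := lintegral_mono hdrift
        _ = ∫⁻ y, W y ∂ν i + b := by simp [lintegral_add_right]
    have h2 := add_sum_range_le_of_add_le (w := fun i => ∫⁻ y, W y ∂ν i)
      (x := fun i => ∫⁻ y, V y ∂ν i) (y := fun _ => b) h1 (n + 1)
    have h3 : ∫⁻ y, W y ∂ν 0 = W x := lintegral_dirac' x hW
    have h4 : ∑ i ∈ Finset.range (n + 1), ∫⁻ y, V y ∂ν i ≤ (n + 1) * (W x + b) := by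
      refine (le_add_self.trans h2).trans ?_
      simp only [h3, Finset.sum_const, Finset.card_range, nsmul_eq_mul, Nat.cast_add, Nat.cast_one]
      rw [mul_add]
      gcongr
      calc W x = 1 * W x := (one_mul _).symm
        _ ≤ (n + 1) * W x := by gcongr; exact le_add_self
    rw [lintegral_cesaro]
    calc _ ≤ ((n : ℝ≥0∞) + 1)⁻¹ * ((n + 1) * (W x + b)) := by gcongr
      _ = W x + b := by rw [← mul_assoc, natCast_add_one_inv_mul, one_mul]
  let m : ℕ → ProbabilityMeasure X := fun n => ⟨cesaro κ x n, inferInstance⟩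
  have htight : IsTightMeasureSet {((μ : ProbabilityMeasure X) : Measure X) | μ ∈ Set.range m} := by
    rw [isTightMeasureSet_iff_exists_isCompact_measure_compl_le]
    intro ε hε
    have hC : W x + b ≠ ⊤ := ENNReal.add_ne_top.2 ⟨hx, hb⟩
    obtain ⟨r, hr0, hr⟩ : ∃ r : ℝ≥0, r ≠ 0 ∧ (W x + b) / r ≤ ε := by
      rcases eq_or_ne ε ⊤ with rfl | hεt
      · exact ⟨1, one_ne_zero, le_top⟩
      · lift ε to ℝ≥0 using hεt
        lift W x + b to ℝ≥0 using hC with C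
        have hε' : 0 < ε := by exact_mod_cast hε
        -- The summand `1` keeps the level nonzero when `C = 0`.
        refine ⟨C / ε + 1, by positivity, ENNReal.div_le_of_le_mul ?_⟩
        have h5 : C ≤ ε * (C / ε + 1) := by
          rw [mul_add, mul_div_cancel₀ _ hε'.ne']
          exact le_self_add
        exact_mod_cast h5
    refine ⟨_, hcpt r, ?_⟩
    rintro _ ⟨_, ⟨n, rfl⟩, rfl⟩
    refine le_trans ?_ hr
    have h6 : {y | V y ≤ r}ᶜ ⊆ {y | (r : ℝ≥0∞) ≤ V y} := fun y hy =>
      (not_le.1 fun h : V y ≤ r => hy h).le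
    refine (measure_mono h6).trans
      ((meas_ge_le_lintegral_div hV.aemeasurable (by simpa using hr0) ENNReal.coe_ne_top).trans ?_)
    gcongr
    exact hVle n
  -- A limit along the hyperfilter takes the place of a convergent subsequence, so no metrizability
  -- is required.
  obtain ⟨ψ, -, hψ⟩ := (isCompact_closure_of_isTightMeasureSet htight).ultrafilter_le_nhds'
    ((hyperfilter ℕ).map m)
    (Filter.mem_map.2 (Filter.Eventually.of_forall fun n => subset_closure ⟨n, rfl⟩))
  have hlim : Tendsto m (hyperfilter ℕ : Filter ℕ) (𝓝 ψ) := hψ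
  rw [ProbabilityMeasure.tendsto_iff_forall_lintegral_tendsto] at hlim
  refine ⟨ψ, inferInstance, ?_⟩
  refine ext_of_forall_lintegral_eq_of_IsFiniteMeasure fun f => ?_
  have hf : Measurable fun y => (f y : ℝ≥0∞) := f.continuous.measurable.coe_nnreal_ennreal
  rw [Measure.lintegral_bind κ.measurable.aemeasurable hf.aemeasurable]
  obtain ⟨g, hg⟩ := hκ f
  simp_rw [← hg]
  have hinv : Tendsto (fun n : ℕ => ((n : ℝ≥0∞) + 1)⁻¹) (hyperfilter ℕ) (𝓝 0) := by
    have h := (ENNReal.tendsto_inv_nat_nhds_zero).comp (tendsto_add_atTop_nat 1)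
    refine Tendsto.mono_left (h.congr fun n => ?_) Nat.hyperfilter_le_atTop
    simp
  have hzero {a : ℕ → ℝ≥0∞} (ha : ∀ n, a n ≤ nndist f 0) :
      Tendsto (fun n : ℕ => ((n : ℝ≥0∞) + 1)⁻¹ * a n) (hyperfilter ℕ) (𝓝 0) := by
    have h := ENNReal.Tendsto.mul_const (b := (nndist f 0 : ℝ≥0∞)) hinv
      (Or.inr ENNReal.coe_ne_top)
    rw [zero_mul] at h
    exact tendsto_of_tendsto_of_tendsto_of_le_of_le tendsto_const_nhds h (fun _ => zero_le)
      fun n => by beta_reduce; gcongr; exact ha n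
  have hbound : ∀ y, (f y : ℝ≥0∞) ≤ nndist f 0 := fun y => by
    exact_mod_cast BoundedContinuousFunction.NNReal.upper_bound f y
  have h1 := (hlim g).add (hzero (a := fun _ => f x) fun _ => hbound x)
  have h2 := (hlim f).add (hzero (a := fun n => ∫⁻ y, f y ∂ν (n + 1)) fun n => by
    calc ∫⁻ y, (f y : ℝ≥0∞) ∂ν (n + 1) ≤ ∫⁻ y, (nndist f 0 : ℝ≥0∞) ∂ν (n + 1) :=
          lintegral_mono hbound
      _ = _ := by simp)
  rw [add_zero] at h1 h2
  -- The end terms vanish in the limit. The Feller property makes `g` a legitimate test function, so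
  -- `∫ g dψ = ∫ f dψ`.
  refine tendsto_nhds_unique h1 (h2.congr fun n => ?_)
  have h3 := lintegral_cesaro_bind κ x n hf
  simp_rw [← hg] at h3
  exact h3.symm

end KrylovBogoliubov

/-! ### Feller property and drift of the wealth kernel -/

open scoped BoundedContinuousFunction

namespace Primitives

variable {Z E₁ E₂ E₃ : Type*} [Fintype Z] [MeasurableSpace Z]
    [MeasurableSingletonClass Z] [MeasurableSpace E₁] [MeasurableSpace E₂]
    [MeasurableSpace E₃] (M : Primitives Z E₁ E₂ E₃)

lemma measurable_transition (k : ℝ≥0) :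
    Measurable fun w : Z × E₂ × E₃ => (M.R w.1 w.2.1 * k + M.Y w.1 w.2.2, w.1) := by
  have hR : Measurable (fun p : Z × E₂ => M.R p.1 p.2) :=
    measurable_from_prod_countable_right M.measurable_R
  have hY : Measurable (fun p : Z × E₃ => M.Y p.1 p.2) :=
    measurable_from_prod_countable_right M.measurable_Y
  have h1 := hR.comp (f := fun p : Z × E₂ × E₃ => (p.1, p.2.1)) (by fun_prop)
  have h2 := hY.comp (f := fun p : Z × E₂ × E₃ => (p.1, p.2.2)) (by fun_prop)
  exact ((h1.mul_const k).add h2).prodMk measurable_fst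

/-- The kernel does not involve the discount innovation; integrating over this probability
coordinate as well puts it in terms of `step`. -/
lemma lintegral_Q {c : ℝ≥0 → Z → ℝ≥0} (hc : Feasible c) (x : ℝ≥0 × Z) {F : ℝ≥0 × Z → ℝ≥0∞}
    (hF : Measurable F) :
    ∫⁻ y, F y ∂M.Q hc x =
      M.step (fun z' e => F (M.R z' e.2.1 * (x.1 - extend c x.1 x.2) + M.Y z' e.2.2, z')) x.2 := by
  have hm := M.measurable_transition (x.1 - extend c x.1 x.2)
  change ∫⁻ y, F y ∂(((M.P x.2).toMeasure.prod (M.πζ.prod M.πη)).map _) = _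
  rw [lintegral_map hF hm]
  refine (lintegral_prod _ (hF.comp hm).aemeasurable).trans ?_
  rw [lintegral_fintype, step]
  refine Finset.sum_congr rfl fun z' _ => ?_
  rw [PMF.toMeasure_apply_singleton _ _ (measurableSet_singleton z'), mul_comm]
  congr 1
  have h1 : Measurable fun e : E₂ × E₃ =>
      F (M.R z' e.1 * (x.1 - extend c x.1 x.2) + M.Y z' e.2, z') :=
    (hF.comp hm).comp (measurable_const.prodMk measurable_id)
  exact ((measurePreserving_snd (μ := M.πε) (ν := M.πζ.prod M.πη)).lintegral_comp h1).symm

instance isMarkovKernel_Q {c : ℝ≥0 → Z → ℝ≥0} (hc : Feasible c) : IsMarkovKernel (M.Q hc) := by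
  refine ⟨fun x => ?_⟩
  have : IsProbabilityMeasure (M.P x.2).toMeasure := inferInstance
  exact Measure.isProbabilityMeasure_map
    (M.measurable_transition (x.1 - extend c x.1 x.2)).aemeasurable

lemma transfer_smul (C : ℝ≥0∞) (g w : Z → ℝ≥0∞) (z : Z) :
    M.transfer (fun z => C * g z) w z = C * M.transfer g w z := by
  simp only [transfer, Finset.mul_sum]
  exact Finset.sum_congr rfl fun z' _ => by ring

variable {M} {s : ℝ≥0} {c : ℝ≥0 → Z → ℝ≥0}

lemma IsRegularPolicy.savings_le (hc : M.IsRegularPolicy s c) (hs : s ≤ 1) (a : ℝ≥0) (z : Z) :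
    a - c a z ≤ s * a := by
  rw [tsub_le_iff_right]
  calc a = s * a + (1 - s) * a := by rw [← add_mul, add_tsub_cancel_of_le hs, one_mul]
    _ ≤ s * a + c a z := by gcongr; exact hc.lower a z

/-- For fixed shocks next period's state is continuous in wealth because `c` is; bounded convergence
does the rest, and continuity in `z` is automatic. -/
lemma IsRegularPolicy.feller [TopologicalSpace Z] [DiscreteTopology Z]
    (hc : M.IsRegularPolicy s c) (f : ℝ≥0 × Z →ᵇ ℝ≥0) :
    ∃ g : ℝ≥0 × Z →ᵇ ℝ≥0, ∀ x, (g x : ℝ≥0∞) = ∫⁻ y, f y ∂M.Q hc.feasible x := by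
  have hf : Measurable fun y => (f y : ℝ≥0∞) := f.continuous.measurable.coe_nnreal_ennreal
  have hbound : ∀ y, (f y : ℝ≥0∞) ≤ nndist f 0 := fun y => by
    exact_mod_cast BoundedContinuousFunction.NNReal.upper_bound f y
  have hle x : ∫⁻ y, f y ∂M.Q hc.feasible x ≤ nndist f 0 := by
    calc _ ≤ ∫⁻ y, (nndist f 0 : ℝ≥0∞) ∂M.Q hc.feasible x := lintegral_mono hbound
      _ = _ := by simp
  have htop x : ∫⁻ y, f y ∂M.Q hc.feasible x ≠ ⊤ := ne_top_of_le_ne_top ENNReal.coe_ne_top (hle x)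
  have hcont : Continuous fun x => ∫⁻ y, f y ∂M.Q hc.feasible x := by
    rw [continuous_prod_of_discrete_right]
    intro z
    rw [continuous_iff_seqContinuous]
    intro as a has
    simp only [M.lintegral_Q hc.feasible _ hf, Function.comp_def, hc.extend_eq]
    refine tendsto_finsetSum _ fun z' _ => ?_
    refine ENNReal.Tendsto.const_mul ?_ (Or.inr (M.P_ne_top z z'))
    refine tendsto_lintegral_of_dominated_convergence (fun _ => (nndist f 0 : ℝ≥0∞))
      (fun n => ?_) (fun n => Eventually.of_forall fun e => hbound _) (by simp) ?_
    · have h1 := M.measurable_R z'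
      have h2 := M.measurable_Y z'
      exact hf.comp (by fun_prop)
    · refine Eventually.of_forall fun e => ?_
      refine (ENNReal.continuous_coe.tendsto _).comp ((f.continuous.tendsto _).comp ?_)
      have h1 : Tendsto (fun n => as n - c (as n) z) atTop (𝓝 (a - c a z)) :=
        has.sub (((hc.continuous z).tendsto a).comp has)
      exact ((h1.const_mul _).add_const _).prodMk_nhds tendsto_const_nhds
  have hcont' : Continuous fun x => (∫⁻ y, f y ∂M.Q hc.feasible x).toNNReal :=
    continuous_iff_continuousAt.2 fun x =>
      (ENNReal.tendsto_toNNReal (htop x)).comp (hcont.tendsto x)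
  refine ⟨BoundedContinuousFunction.mkOfBound ⟨_, hcont'⟩ (nndist f 0) fun x y => ?_, fun x => ?_⟩
  · have hb x : (∫⁻ y, f y ∂M.Q hc.feasible x).toNNReal ≤ nndist f 0 :=
      ENNReal.toNNReal_mono ENNReal.coe_ne_top (hle x)
    have h1 : ((∫⁻ y, f y ∂M.Q hc.feasible x).toNNReal : ℝ) ≤ nndist f 0 := hb x
    have h2 : ((∫⁻ w, f w ∂M.Q hc.feasible y).toNNReal : ℝ) ≤ nndist f 0 := hb y
    simp only [ContinuousMap.coe_mk, NNReal.dist_eq]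
    rw [abs_le]
    constructor <;> linarith [NNReal.coe_nonneg (∫⁻ y, f y ∂M.Q hc.feasible x).toNNReal,
      NNReal.coe_nonneg (∫⁻ w, f w ∂M.Q hc.feasible y).toNNReal]
  · exact ENNReal.coe_toNNReal (htop x)

/-- Wealth weighted by the resolvent is a Foster-Lyapunov function. -/
lemma IsRegularPolicy.drift (hc : M.IsRegularPolicy s c) (hs : s ≤ 1) (x : ℝ≥0 × Z) :
    ∫⁻ y, y.1 * M.resolvent (fun z => s * M.meanR z) 1 y.2 ∂M.Q hc.feasible x + x.1 ≤
      x.1 * M.resolvent (fun z => s * M.meanR z) 1 x.2 +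
        ∑ z, M.transfer M.meanY (M.resolvent (fun z => s * M.meanR z) 1) z := by
  set h := M.resolvent (fun z => s * M.meanR z) 1
  have hF : Measurable fun y : ℝ≥0 × Z => (y.1 : ℝ≥0∞) * h y.2 :=
    measurable_fst.coe_nnreal_ennreal.mul ((measurable_of_finite h).comp measurable_snd)
  obtain ⟨a, z⟩ := x
  rw [M.lintegral_Q hc.feasible _ hF]
  simp only [hc.extend_eq]
  have h1 : M.step (fun z' e => ((M.R z' e.2.1 * (a - c a z) + M.Y z' e.2.2 : ℝ≥0) : ℝ≥0∞) * h z') z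
      ≤ a * (s * M.transfer M.meanR h z) + M.transfer M.meanY h z := by
    have h2 z' : ∫⁻ e, ((M.R z' e.2.1 * (a - c a z) + M.Y z' e.2.2 : ℝ≥0) : ℝ≥0∞) * h z'
        ∂M.innovLaw ≤ a * (s * (M.meanR z' * h z')) + M.meanY z' * h z' := by
      have hR := M.measurable_R z'
      have hY := M.measurable_Y z'
      calc _ ≤ ∫⁻ e, (M.R z' e.2.1 * (a * (s * h z')) + M.Y z' e.2.2 * h z') ∂M.innovLaw := by
            refine lintegral_mono fun e => ?_
            rw [ENNReal.coe_add, ENNReal.coe_mul, add_mul, mul_assoc, ← mul_assoc (a : ℝ≥0∞)]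
            gcongr
            rw [← ENNReal.coe_mul, mul_comm a]
            exact ENNReal.coe_le_coe.2 (hc.savings_le hs a z)
        _ = a * (s * (M.meanR z' * h z')) + M.meanY z' * h z' := by
            rw [lintegral_add_left (by fun_prop), lintegral_mul_const _ (by fun_prop),
              lintegral_mul_const _ (by fun_prop), M.lintegral_R,
              M.lintegral_Y (h := fun y => (M.Y z' y : ℝ≥0∞)) hY.coe_nnreal_ennreal, meanY]
            ring
    calc _ ≤ ∑ z', M.P z z' * (a * (s * (M.meanR z' * h z')) + M.meanY z' * h z') := by
          unfold step
          gcongr with z' _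
          exact h2 z'
      _ = _ := by
          simp only [transfer, Finset.mul_sum, mul_add, Finset.sum_add_distrib]
          congr 1
          exact Finset.sum_congr rfl fun z' _ => by ring
  calc _ ≤ a * (s * M.transfer M.meanR h z) + M.transfer M.meanY h z + a := by gcongr
    _ = a * h z + M.transfer M.meanY h z := by
        simp only [h]
        rw [M.resolvent_eq _ _ z, transfer_smul, Pi.one_apply]
        ring
    _ ≤ _ := by
        gcongr
        exact Finset.single_le_sum (f := M.transfer M.meanY h) (fun _ _ => zero_le)
          (Finset.mem_univ z)

/-- The drift pays out wealth itself, whose sublevel sets `[0, r] × Z` are compact as `Z` is finite.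
Starting from zero wealth makes the initial Lyapunov value `0`. -/
theorem IsRegularPolicy.exists_invariant [Nonempty Z] (hM : M.Regular) (hs : s ≤ 1)
    (hR : ∀ z, M.resolvent (fun z => s * M.meanR z) 1 z ≠ ⊤) (hc : M.IsRegularPolicy s c) :
    ∃ ψ : Measure (ℝ≥0 × Z), IsProbabilityMeasure ψ ∧ (M.Q hc.feasible).Invariant ψ := by
  let _ : TopologicalSpace Z := ⊥
  have : DiscreteTopology Z := ⟨rfl⟩
  set h := M.resolvent (fun z => s * M.meanR z) 1
  obtain ⟨z⟩ := ‹Nonempty Z›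
  refine exists_invariant_of_drift (M.Q hc.feasible) hc.feller (V := fun x => (x.1 : ℝ≥0∞))
    (W := fun x => x.1 * h x.2) measurable_fst.coe_nnreal_ennreal
    (measurable_fst.coe_nnreal_ennreal.mul ((measurable_of_finite h).comp measurable_snd))
    (ENNReal.sum_ne_top.2 fun z _ => M.transfer_ne_top hM.meanY_ne_top hR z)
    (hc.drift hs) (x := (0, z)) (by simp) fun r => ?_
  have h1 : {y : ℝ≥0 × Z | (y.1 : ℝ≥0∞) ≤ r} = Set.Icc 0 r ×ˢ Set.univ := by
    ext y
    simp
  rw [h1]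
  exact isCompact_Icc.prod isCompact_univ

end Primitives

/-! ### From the stated assumptions to conditions on the primitives -/

namespace Shocks

variable {Z E₁ E₂ E₃ : Type*} [Fintype Z] [MeasurableSpace Z]
    [MeasurableSingletonClass Z] [MeasurableSpace E₁] [MeasurableSpace E₂]
    [MeasurableSpace E₃] {M : Primitives Z E₁ E₂ E₃}
    {Ω : Type*} [MeasurableSpace Ω] {μ : Measure Ω} [IsProbabilityMeasure μ] (S : Shocks M μ)

lemma savingsBound {s : ℝ≥0} (hs : S.LinearSavingsBound s) : M.SavingsBound s := by
  refine ⟨hs.1, fun a z ha => (Eq.le ?_).trans (hs.2 a z ha)⟩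
  have h := S.lintegral_condOn_next z 0 (T := Unit) (H := fun _ => ()) measurable_const
    (F := fun _ z' e => (M.β z' e.1 : ℝ≥0∞) * M.R z' e.2.1 *
      M.marginal (M.R z' e.2.1 * s * a)) fun z' => by
      have h1 := M.measurable_β z'
      have h2 := M.measurable_R z'
      exact Measurable.mul (by fun_prop) (M.measurable_marginal.comp (by fun_prop))
  refine Eq.trans ?_ h.symm
  rw [lintegral_congr_ae (g := fun _ => M.step (fun z' e => (M.β z' e.1 : ℝ≥0∞) * M.R z' e.2.1 *
      M.marginal (M.R z' e.2.1 * s * a)) z)]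
  · simp
  · filter_upwards [S.condOn_chain_zero z] with ω hω
    rw [hω]

lemma resolvent_meanR_ne_top {GR : ℝ} (hGR : HasGrowthRate μ S.ret GR) {s : ℝ≥0}
    (hs : s * GR < 1) (z : Z) : M.resolvent (fun z => s * M.meanR z) 1 z ≠ ⊤ := by
  have h := S.resolvent_ne_top_of_growth (φ := fun z e => M.R z e.2.1)
    (fun z => (M.measurable_R z).comp (measurable_fst.comp measurable_snd)) hGR s hs z
  simpa only [M.lintegral_R] using h

lemma regular {Gβ GβR GR : ℝ}
    (hGβ : HasGrowthRate μ S.beta Gβ) (hGβ_lt : Gβ < 1)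
    (hGβR : HasGrowthRate μ (fun t ω => S.beta t ω * S.ret t ω) GβR) (hGβR_lt : GβR < 1)
    (hY : ∫⁻ ω, (S.income 1 ω : ℝ≥0∞) ∂μ < ⊤)
    (huY : ∫⁻ ω, M.marginal (S.income 1 ω) ∂μ < ⊤)
    (hGR : HasGrowthRate μ S.ret GR) : M.Regular := by
  have mβ z : Measurable fun e : E₁ × E₂ × E₃ => M.β z e.1 :=
    (M.measurable_β z).comp measurable_fst
  have mR z : Measurable fun e : E₁ × E₂ × E₃ => M.R z e.2.1 :=
    (M.measurable_R z).comp (measurable_fst.comp measurable_snd)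
  have mY z : Measurable fun e : E₁ × E₂ × E₃ => M.Y z e.2.2 :=
    (M.measurable_Y z).comp (measurable_snd.comp measurable_snd)
  refine ⟨fun z => ?_, fun z => ?_, fun z => ?_, fun z => ?_, fun z => ?_, fun z => ?_⟩
  · have h := S.lintegral_innovLaw_ne_top (φ := fun z e => (M.β z e.1 : ℝ≥0∞))
      (fun z => (mβ z).coe_nnreal_ennreal) (by simpa using! hGβ.finite 1) z
    rwa [M.lintegral_β] at h
  · have h := S.lintegral_innovLaw_ne_top (φ := fun z e => (M.R z e.2.1 : ℝ≥0∞))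
      (fun z => (mR z).coe_nnreal_ennreal) (by simpa using! hGR.finite 1) z
    rwa [M.lintegral_R] at h
  · have h := S.lintegral_innovLaw_ne_top (φ := fun z e => (M.Y z e.2.2 : ℝ≥0∞))
      (fun z => (mY z).coe_nnreal_ennreal) hY.ne z
    rwa [M.lintegral_Y (h := fun y => (M.Y z y : ℝ≥0∞))
      (M.measurable_Y z).coe_nnreal_ennreal] at h
  · have h := S.lintegral_innovLaw_ne_top (φ := fun z e => M.marginal (M.Y z e.2.2))
      (fun z => M.measurable_marginal.comp (mY z)) huY.ne z
    rwa [M.lintegral_Y (h := fun y => M.marginal (M.Y z y)) (M.measurable_marginal_Y z)] at h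
  · have h := S.resolvent_ne_top_of_growth (φ := fun z e => M.β z e.1) mβ hGβ 1 (by simpa) z
    simpa only [M.lintegral_β, ENNReal.coe_one, one_mul] using h
  · have h := S.resolvent_ne_top_of_growth (φ := fun z e => M.β z e.1 * M.R z e.2.1)
      (fun z => (mβ z).mul (mR z)) hGβR 1 (by simpa) z
    simpa only [ENNReal.coe_mul, M.lintegral_β_R, ENNReal.coe_one, one_mul] using h

end Shocks

end IncomeFluctuation

end

theorem mainTheorem4 {Z E₁ E₂ E₃ Ω : Type*} [Fintype Z] [MeasurableSpace Z]
    [MeasurableSingletonClass Z] [MeasurableSpace E₁] [MeasurableSpace E₂]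
    [MeasurableSpace E₃] [MeasurableSpace Ω]
    (M : Primitives Z E₁ E₂ E₃) (μ : Measure Ω) [IsProbabilityMeasure μ] (S : Shocks M μ)
    (Gβ GβR GR : ℝ)
    (hGβ : HasGrowthRate μ S.beta Gβ) (hGβ_lt : Gβ < 1)
    (hGβR : HasGrowthRate μ (fun t ω => S.beta t ω * S.ret t ω) GβR) (hGβR_lt : GβR < 1)
    (hY : ∫⁻ ω, (S.income 1 ω : ℝ≥0∞) ∂μ < ⊤)
    (huY : ∫⁻ ω, M.marginal (S.income 1 ω) ∂μ < ⊤)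
    (hGR : HasGrowthRate μ S.ret GR)
    (s : ℝ≥0) (hs : S.LinearSavingsBound s) (hsGR : s * GR < 1) :
    ∃ (c : ℝ≥0 → Z → ℝ≥0) (hc : Feasible c),
      M.IsCandidate c ∧ S.IsOptimal c ∧
      (∀ d : ℝ≥0 → Z → ℝ≥0, M.IsCandidate d → S.IsOptimal d →
        ∀ (a : ℝ≥0) (z : Z), 0 < a → d a z = c a z) ∧
      ∃ ψ : Measure (ℝ≥0 × Z), IsProbabilityMeasure ψ ∧ (M.Q hc).Invariant ψ := by
  have hM := S.regular hGβ hGβ_lt hGβR hGβR_lt hY huY hGR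
  obtain ⟨c, hc, hE⟩ := M.exists_isEulerSol_self hM (S.savingsBound hs)
  obtain ⟨ω⟩ := nonempty_of_isProbabilityMeasure μ
  have : Nonempty Z := ⟨S.chain 0 ω⟩
  exact ⟨c, hc.feasible, hc.isCandidate hM, S.isOptimal_of_isEulerSol hM hc hE,
    fun d hd hopt a z ha => S.eq_of_isOptimal hM hc hE hopt ha (hd.pos a z ha),
    hc.exists_invariant hM hs.1.le (S.resolvent_meanR_ne_top hGR hsGR)⟩
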